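/- Let $G$ be a finite group. Let $\mathbb{Z}G$ be its integral group ring and let $V(\mathbb{Z}G)$ be the group of units $u=\sum_{h\in G}u_h h$ of $\mathbb{Z}G$ of augmentation $\sum_{h\in G}u_h=1$. For $g\in G$ let $\varepsilon_g(u)=\sum_{h\in g^G}u_h$ denote the partial augmentation of $u$ with respect to the conjugacy class $g^G$ of $g$, and let $o(\cdot)$ denote the order of an element. The same notation is used for quotients of $G$. Let $N$ be a soluble normal subgroup of $G$. Suppose that for every unit $u\in V(\mathbb{Z}[G/N])$ of finite order there is $g\in G/N$ with $o(g)=o(u)$ and $\varepsilon_g(u)\neq 0$. Then for every unit $u\in V(\mathbb{Z}G)$ of finite order there is $g\in G$ with $o(g)=o(u)$ and $\varepsilon_g(u)\neq 0$. In particular, (SIP-C) holds for $\mathbb{Z}G$: every finite cyclic subgroup of $V(\mathbb{Z}G)$ is isomorphic to a subgroup of $G$. -/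

import Mathlib

/-- The augmentation `ℤG → ℤ`, the ring homomorphism that sends every group element to `1`. -/
noncomputable def augmentation (G : Type*) [Group G] : MonoidAlgebra ℤ G →+* ℤ :=
  (MonoidAlgebra.lift ℤ ℤ G (1 : G →* ℤ)).toRingHom

/-- The normalised unit group `V(ℤG)`: the units of `ℤG` of augmentation `1`. -/
noncomputable def normalizedUnits (G : Type*) [Group G] : Subgroup (MonoidAlgebra ℤ G)ˣ :=
  (Units.map (augmentation G : MonoidAlgebra ℤ G →* ℤ)).ker

open scoped Classical in
/-- The partial augmentation `ε_x(u)`: the sum of the coefficients of `u` over the conjugacy class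
of `x`. -/
noncomputable def partialAugmentation {G : Type*} [Group G] (x : G) (u : MonoidAlgebra ℤ G) : ℤ :=
  ∑ g ∈ u.coeff.support with IsConj x g, u.coeff g

/-- The subgroup isomorphism property for cyclic subgroups (SIP-C): every finite cyclic subgroup of
`V(ℤG)` is isomorphic to a subgroup of `G`. -/
def SIPC (G : Type*) [Group G] : Prop :=
  ∀ C : Subgroup (normalizedUnits G), Finite C → IsCyclic C → ∃ H : Subgroup G, Nonempty (C ≃* H)

/-! For a torsion unit u and x in G, the map m ↦ x⁻¹mu on ℤG has trace |C_G(x)| ε_x(u), so a partial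
augmentation vanishes as soon as this trace does. The criterion is `trace_eq_zero_of_ker_le_range`:
if A is integral, A^n = 1, p ∣ n, and A^(n/p) acts freely in characteristic p (all Jordan blocks
have size p), then the complex eigenvalue multiplicities of A are unchanged under multiplication by
p-power roots of unity of order dividing n. These sum to zero, hence tr A = 0. With u of order m and
x^m ≠ 1 this already shows that ε_x(u) ≠ 0 forces o(x) ∣ o(u).

By induction on |G| the soluble subgroup may be replaced by an elementary abelian p-group N. Given a
witness for the image of u in ℤ[G/N], some x above it (up to conjugacy) has ε_x(u) ≠ 0, and o(x)
lies between the order of the image and o(u) for divisibility. If o(x) ≠ o(u), choose a prime r ∣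
o(u)/o(x). Then v = u^(o(u)/r) has order r and maps to 1, which forces r = p, and x^(o(u)/p) = 1. So
the power of order p of m ↦ x⁻¹mu is right multiplication by v. If v acts freely in characteristic
p, the criterion gives ε_x(u) = 0, a contradiction.

That v acts freely (`ker_translationEnd_sub_one_le`) is a weak form of Weiss' theorem. Over a
valuation ring R of residue characteristic p one shows H¹(⟨v⟩, RG) = 0 by passing down the
invariants of subgroups H ≤ N: on the N-invariants v is trivial, and `exists_smul_eq_of_invariants`
goes from H⟨n⟩ to H. The vanishing lifts fixed vectors from the residue field to R, and by
Berman–Higman there are only |G|/p dimensions of fixed vectors over ℂ, which leaves room only for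
blocks of size p. -/

section CyclicCohomology

/-! ### Cohomology of two commuting operators of order p -/

variable {S M : Type*} [CommRing S] [AddCommGroup M] [Module S M]

/-- The geometric sum `1 + c + ⋯ + c ^ (p - 1)` expanded around `c = 1`. -/
lemma geom_sum_prime_eq (p : ℕ) (hp : p.Prime) (c : S) :
    ∃ b : S, ∑ j ∈ Finset.range p, c ^ j = (c - 1) ^ (p - 1) + p * (1 + (c - 1) * b) := by
  have h := congrArg (Polynomial.eval (c - 1)) (Polynomial.geom_sum_X_comp_X_add_one_eq_sum (R := S) p)
  rw [Polynomial.eval_comp] at h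
  simp only [Polynomial.eval_finsetSum, Polynomial.eval_pow, Polynomial.eval_X,
    Polynomial.eval_add, Polynomial.eval_one, sub_add_cancel, Polynomial.eval_mul,
    Polynomial.eval_natCast] at h
  obtain ⟨m, rfl⟩ : ∃ m, p = m + 2 := ⟨p - 2, by have := hp.two_le; omega⟩
  rw [h, Finset.sum_range_succ, Finset.sum_range_succ']
  -- Only the inner binomial coefficients are treated here; the outer two give the power `(c - 1) ^
  -- (p - 1)` and the constant term `p`.
  have hd : ∀ i ∈ Finset.range m, ∃ b : S,
      ((m + 2).choose (i + 1 + 1) : S) * (c - 1) ^ (i + 1) = (m + 2 : ℕ) * ((c - 1) * b) := by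
    intro i hi
    obtain ⟨d, hd⟩ := hp.dvd_choose_self (k := i + 1 + 1) (by omega)
      (by have := Finset.mem_range.1 hi; omega)
    exact ⟨d * (c - 1) ^ i, by rw [hd]; push_cast; ring⟩
  choose! b hb using hd
  refine ⟨∑ i ∈ Finset.range m, b i, ?_⟩
  rw [Finset.sum_congr rfl hb, ← Finset.mul_sum, ← Finset.mul_sum]
  simp
  ring

/-- Where `1 + n + ⋯ + n ^ (p - 1)` acts as zero, `p` is associated to `(n - 1) ^ (p - 1)`. -/
lemma exists_prime_smul_eq (p : ℕ) (hp : p.Prime) (n : S)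
    (hN : ∀ y : M, (∑ j ∈ Finset.range p, n ^ j) • y = 0)
    (hinj : ∀ y : M, (n - 1) • y = 0 → y = 0) :
    ∃ e d : S, (∀ y : M, (p : S) • y = (e * (n - 1) ^ (p - 1)) • y) ∧
      ∀ y : M, (d * e) • y = y := by
  obtain ⟨b, hb⟩ := geom_sum_prime_eq p hp n
  set x := (n - 1) with hx
  -- The truncated geometric series inverts `1 + x * b` up to `(-x * b) ^ (p - 1)`, and this error
  -- is itself a multiple of `x ^ (p - 1)`, so `e` can absorb it.
  set e : S := -(∑ i ∈ Finset.range (p - 1), (-x * b) ^ i) + p * (-b) ^ (p - 1) with he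
  have hkey : (p : S) = e * x ^ (p - 1)
      + (∑ j ∈ Finset.range p, n ^ j) * ∑ i ∈ Finset.range (p - 1), (-x * b) ^ i := by
    have h1 := mul_neg_geom_sum (-x * b) (p - 1)
    rw [hb, he]
    have h2 : (-x * b) ^ (p - 1) = (-b) ^ (p - 1) * x ^ (p - 1) := by rw [← mul_pow]; ring
    rw [h2] at h1
    linear_combination (p : S) * (-h1)
  have h1 : ∀ y : M, (p : S) • y = (e * x ^ (p - 1)) • y := by
    intro y
    conv_lhs => rw [hkey]
    rw [add_smul, mul_comm (∑ j ∈ Finset.range p, n ^ j), mul_smul _ (∑ j ∈ Finset.range p, n ^ j),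
      hN, smul_zero, add_zero]
  have hpow : ∀ (k : ℕ) (y : M), x ^ k • y = 0 → y = 0 := by
    intro k
    induction k with
    | zero => intro y h; simpa using h
    | succ k ih => intro y h; rw [pow_succ, mul_smul] at h; exact hinj _ (ih _ h)
  refine ⟨e, -(1 + x * b), h1, fun y => ?_⟩
  -- Substituting `p = e * x ^ (p - 1)` turns this into `(1 + (1 + x * b) * e) * x ^ (p - 1)`;
  -- cancelling `x` makes `-(1 + x * b)` an inverse of `e` on `M`.
  have h2 : (x ^ (p - 1) + p * (1 + x * b)) • y = 0 := by rw [← hb]; exact hN y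
  rw [← sub_eq_zero]
  apply hpow (p - 1)
  have h3 : (p * (1 + x * b)) • y = ((1 + x * b) * (e * x ^ (p - 1))) • y := by
    rw [mul_comm, mul_smul, h1, ← mul_smul]
  rw [add_smul, h3] at h2
  rw [smul_sub, ← mul_smul, ← neg_eq_zero, neg_sub]
  rw [← h2, sub_eq_add_neg, ← neg_smul]
  congr 2
  ring

/-- Bootstrapping the splitting of `ker T ^ (p - 1)` modulo `π` to smaller powers. -/
lemma exists_split_of_pow_smul (p : ℕ) (π T : S)
    (hJ : ∀ x x' : M, T ^ (p - 1) • x = π • x' →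
      ∃ x₁ x₂ x₃ : M, x = x₁ + T • x₂ ∧ T • x₁ = π • x₃)
    (k : ℕ) (hk : k < p - 1) (z z' : M) (hz : T ^ (p - 1 - k) • z = π • z') :
    ∃ x₁ x₂ x₃ : M, z = x₁ + T ^ (k + 1) • x₂ ∧ T • x₁ = π • x₃ := by
  induction k generalizing z z' with
  | zero => simpa using hJ z z' (by simpa using hz)
  | succ k ih =>
    obtain ⟨z₁, w₁, z₃, h1, h2⟩ := ih (by omega) z (T • z') (by
      rw [show p - 1 - k = (p - 1 - (k + 1)) + 1 by omega, pow_succ', mul_smul, hz, smul_comm])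
    -- The exponent `p - 1 - (k + 1)` is at least 1, so the part coming from `z₁` is a multiple of
    -- `π`.
    have h3 : T ^ (p - 1) • w₁ = π • (z' - T ^ (p - 1 - (k + 1) - 1) • z₃) := by
      rw [smul_sub, ← hz, h1, smul_add, ← mul_smul, ← pow_add,
        show p - 1 - (k + 1) + (k + 1) = p - 1 by omega, smul_comm π, ← h2, ← mul_smul,
        ← pow_succ, show p - 1 - (k + 1) - 1 + 1 = p - 1 - (k + 1) by omega]
      abel
    obtain ⟨x₁, x₂, x₃, h4, h5⟩ := hJ _ _ h3
    refine ⟨z₁ + T ^ (k + 1) • x₁, x₂, z₃ + T ^ (k + 1) • x₃, ?_, ?_⟩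
    · rw [h1, h4, smul_add, ← mul_smul (T ^ (k + 1)) T, ← pow_succ, ← add_assoc]
    · rw [smul_add, h2, smul_comm, h5, smul_add, smul_comm π]

/-- The divisibility step: modulo `T M` a solution of `N y = 0` is divisible to high order. -/
lemma exists_pow_smul_sub_eq (p : ℕ) (π T e b : S)
    (hinj : ∀ y : M, π • y = 0 → y = 0) (hpe : ∀ y : M, (p : S) • y = (e * π ^ (p - 1)) • y)
    (hJ : ∀ x x' : M, T ^ (p - 1) • x = π • x' →
      ∃ x₁ x₂ x₃ : M, x = x₁ + T • x₂ ∧ T • x₁ = π • x₃)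
    (y : M) (hy : ∀ w : M, (T ^ (p - 1) + p * (1 + T * b)) • (y - T • w) = 0)
    (k : ℕ) (hk : k < p - 1) :
    ∃ w z z' : M, T ^ k • (y - T • w) = π ^ k • z ∧ T • z = π • z' := by
  have hpow : ∀ (k : ℕ) (y : M), π ^ k • y = 0 → y = 0 := by
    intro k
    induction k with
    | zero => intro y h; simpa using h
    | succ k ih => intro y h; rw [pow_succ, mul_smul] at h; exact hinj _ (ih _ h)
  have step : ∀ k < p - 1, (∃ w z : M, T ^ k • (y - T • w) = π ^ k • z) →
      ∃ w z z' : M, T ^ k • (y - T • w) = π ^ k • z ∧ T • z = π • z' := by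
    rintro k hk ⟨w, z, hz⟩
    have h0 := hy w
    set y' := y - T • w with hy'
    -- The norm relation gives `T ^ (p - 1) y' = -p (1 + T b) y'`, which is divisible by `π ^ (p -
    -- 1)`. Cancelling `π ^ k` leaves at least one factor `π`, since `k < p - 1`.
    have h1 : T ^ (p - 1 - k) • z = π • (-(π ^ (p - 2 - k) * e * (1 + T * b)) • y') := by
      rw [← sub_eq_zero]
      apply hpow k
      rw [smul_sub, smul_comm, ← hz, ← mul_smul, ← pow_add,
        show p - 1 - k + k = p - 1 by omega]
      have h2 : ((p : S) * (1 + T * b)) • y' =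
          (π ^ k * (π * (π ^ (p - 2 - k) * e * (1 + T * b)))) • y' := by
        rw [mul_comm, mul_smul, hpe, ← mul_smul]
        congr 1
        rw [show p - 1 = k + (1 + (p - 2 - k)) by omega, pow_add, pow_add]
        ring
      rw [add_smul, h2] at h0
      rw [← h0, neg_smul, smul_neg, smul_neg, sub_neg_eq_add, ← mul_smul, ← mul_smul, mul_assoc]
    obtain ⟨x₁, x₂, x₃, h4, h5⟩ := exists_split_of_pow_smul p π T hJ k hk z _ h1
    -- Moving `w` by `π ^ k • x₂` removes the summand `T ^ (k + 1) • x₂` of `z`.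
    refine ⟨w + π ^ k • x₂, x₁, x₃, ?_, h5⟩
    rw [show y - T • (w + π ^ k • x₂) = y' - T • π ^ k • x₂ by rw [hy', smul_add]; abel,
      smul_sub, hz, h4, smul_add, ← mul_smul T, ← mul_smul (T ^ k), ← mul_smul (π ^ k)]
    rw [show T ^ k * (T * π ^ k) = π ^ k * T ^ (k + 1) by ring]
    abel
  induction k with
  | zero => exact step 0 hk ⟨0, y, by simp⟩
  | succ k ih =>
    obtain ⟨w, z, z', h1, h2⟩ := ih (by omega)
    refine step _ hk ⟨w, z', ?_⟩
    rw [pow_succ', mul_smul, h1, smul_comm, h2, ← mul_smul, ← pow_succ]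

/-- `π` annihilates `H¹`. -/
lemma exists_smul_eq_of_norm_smul_eq_zero (p : ℕ) (hp : p.Prime) (n c : S) (hc : c ^ p = 1)
    (hN : ∀ y : M, (∑ j ∈ Finset.range p, n ^ j) • y = 0)
    (hinj : ∀ y : M, (n - 1) • y = 0 → y = 0)
    (hJ : ∀ x x' : M, (c - 1) ^ (p - 1) • x = (n - 1) • x' →
      ∃ x₁ x₂ x₃ : M, x = x₁ + (c - 1) • x₂ ∧ (c - 1) • x₁ = (n - 1) • x₃)
    (y : M) (hy : (∑ j ∈ Finset.range p, c ^ j) • y = 0) :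
    ∃ w : M, (n - 1) • y = (c - 1) • w := by
  obtain ⟨e, d, hpe, hde⟩ := exists_prime_smul_eq p hp n hN hinj
  obtain ⟨b, hb⟩ := geom_sum_prime_eq p hp c
  have hT : (∑ j ∈ Finset.range p, c ^ j) * (c - 1) = 0 := by
    rw [geom_sum_mul, hc, sub_self]
  have hy0 : ∀ w : M, ((c - 1) ^ (p - 1) + p * (1 + (c - 1) * b)) • (y - (c - 1) • w) = 0 := by
    intro w
    rw [← hb, smul_sub, hy, ← mul_smul, hT, zero_smul, sub_zero]
  have h2p := hp.two_le
  obtain ⟨w, z, z', h1, h2⟩ := exists_pow_smul_sub_eq p (n - 1) (c - 1) e b hinj hpe hJ y hy0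
    (p - 2) (by omega)
  set π := n - 1
  set T := c - 1
  have hpow : ∀ (k : ℕ) (y : M), π ^ k • y = 0 → y = 0 := by
    intro k
    induction k with
    | zero => intro y h; simpa using h
    | succ k ih => intro y h; rw [pow_succ, mul_smul] at h; exact hinj _ (ih _ h)
  have h3 := hy0 w
  set y' := y - T • w with hy'
  have h4 : z' + (e * (1 + T * b)) • y' = 0 := by
    apply hpow (p - 1)
    have h5 : T ^ (p - 1) • y' = π ^ (p - 1) • z' := by
      rw [show p - 1 = p - 2 + 1 by omega, pow_succ', mul_smul, h1, smul_comm, h2, ← mul_smul,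
        ← pow_succ]
    rw [add_smul, h5, mul_comm (p : S), mul_smul, hpe, ← mul_smul] at h3
    rw [smul_add, ← mul_smul, ← h3]
    congr 2
    ring
  -- Combine `T z = π z'` with `z' = -e (1 + T b) y'`; the unit `e` is removed afterwards with `d`.
  have h6 : (e * π) • y' = T • (-z - (e * π * b) • y') := by
    have h7 := congrArg (π • ·) h4
    simp only [smul_add, smul_zero, ← h2, ← mul_smul] at h7
    rw [smul_sub T, smul_neg, ← mul_smul T, ← sub_eq_zero, ← h7,
      show π * (e * (1 + T * b)) = e * π + T * (e * π * b) by ring, add_smul]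
    abel
  refine ⟨d • (-z - (e * π * b) • y') + π • w, ?_⟩
  have h8 : π • y' = T • d • (-z - (e * π * b) • y') := by
    rw [smul_comm, ← h6, ← mul_smul, ← mul_assoc, mul_comm, mul_smul, hde]
  rw [smul_add, ← h8, hy', smul_sub, smul_comm π T]
  abel

/-- If `n` and `c` are commuting operators of prime order `p` such that `M` is cohomologically
trivial for `n` and `H¹(⟨c⟩, M ^ n) = 0`, then `H¹(⟨c⟩, M) = 0`. -/
theorem exists_smul_eq_of_invariants (p : ℕ) (hp : p.Prime) (n c : S) (hn : n ^ p = 1)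
    (hc : c ^ p = 1) (htf : ∀ m : M, (p : S) • m = 0 → m = 0)
    (h0 : ∀ m : M, n • m = m → ∃ m', m = (∑ j ∈ Finset.range p, n ^ j) • m')
    (h1 : ∀ m : M, (∑ j ∈ Finset.range p, n ^ j) • m = 0 → ∃ m', m = (n - 1) • m')
    (hX : ∀ x : M, n • x = x → (∑ j ∈ Finset.range p, c ^ j) • x = 0 →
      ∃ x', n • x' = x' ∧ x = (c - 1) • x')
    (m : M) (hm : (∑ j ∈ Finset.range p, c ^ j) • m = 0) : ∃ m', m = (c - 1) • m' := by
  set Nn : S := ∑ j ∈ Finset.range p, n ^ j with hNn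
  set Nc : S := ∑ j ∈ Finset.range p, c ^ j with hNc
  have hTn : (n - 1) * Nn = 0 := by rw [mul_geom_sum, hn, sub_self]
  have hTc : Nc * (c - 1) = 0 := by rw [geom_sum_mul, hc, sub_self]
  have hfix : ∀ m : M, n • Nn • m = Nn • m := by
    intro m
    rw [← sub_eq_zero, ← mul_smul, ← sub_smul,
      show n * Nn - Nn = (n - 1) * Nn by ring, hTn, zero_smul]
  have hNfix : ∀ m : M, n • m = m → Nn • m = (p : S) • m := by
    intro m hm
    have : ∀ j : ℕ, n ^ j • m = m := by
      intro j
      induction j with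
      | zero => simp
      | succ j ih => rw [pow_succ, mul_smul, hm, ih]
    rw [hNn, Finset.sum_smul, Finset.sum_congr rfl fun j _ => this j, Finset.sum_const,
      Finset.card_range, Nat.cast_smul_eq_nsmul]
  -- the invariants and the quotient by them
  let X : Submodule S M := LinearMap.ker (LinearMap.lsmul S M (n - 1))
  have hXmem : ∀ m : M, m ∈ X ↔ n • m = m := by
    intro m
    simp [X, sub_eq_zero]
  have hNL : ∀ y : M ⧸ X, Nn • y = 0 := by
    intro y
    obtain ⟨y, rfl⟩ := Submodule.Quotient.mk_surjective X y
    rw [← Submodule.Quotient.mk_smul, Submodule.Quotient.mk_eq_zero, hXmem]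
    exact hfix y
  have hinj : ∀ y : M ⧸ X, (n - 1) • y = 0 → y = 0 := by
    intro y hy
    obtain ⟨y, rfl⟩ := Submodule.Quotient.mk_surjective X y
    rw [← Submodule.Quotient.mk_smul, Submodule.Quotient.mk_eq_zero, hXmem] at hy
    rw [Submodule.Quotient.mk_eq_zero, hXmem]
    have := hNfix _ hy
    rw [← mul_smul, mul_comm, hTn, zero_smul] at this
    have := htf _ this.symm
    rwa [sub_smul, one_smul, sub_eq_zero] at this
  -- If reduction modulo `n - 1` is pictured as a sum of Jordan blocks for `c - 1`, this says that
  -- only the sizes 1 and `p` occur.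
  have hJ : ∀ x x' : M ⧸ X, (c - 1) ^ (p - 1) • x = (n - 1) • x' →
      ∃ x₁ x₂ x₃ : M ⧸ X, x = x₁ + (c - 1) • x₂ ∧ (c - 1) • x₁ = (n - 1) • x₃ := by
    intro x x' hx
    obtain ⟨x, rfl⟩ := Submodule.Quotient.mk_surjective X x
    obtain ⟨x', rfl⟩ := Submodule.Quotient.mk_surjective X x'
    rw [← Submodule.Quotient.mk_smul, ← Submodule.Quotient.mk_smul, Submodule.Quotient.eq,
      hXmem] at hx
    have hx1 := hNfix _ hx
    rw [smul_sub, ← mul_smul, ← mul_smul Nn (n - 1), mul_comm Nn (n - 1), hTn, zero_smul,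
      sub_zero] at hx1
    obtain ⟨b, hb⟩ := geom_sum_prime_eq p hp c
    set r := (c - 1) ^ (p - 1) • x - (n - 1) • x' with hr
    have hx2 : Nc • Nn • x = (p : S) • (r + (1 + (c - 1) * b) • Nn • x) := by
      rw [hNc, hb, add_smul, ← mul_smul, mul_comm, hx1, smul_add, mul_smul (p : S)]
    -- This is `Nc Nn x` divided by `p`. It is fixed by `n` and `c`, so `Nn x - x₀` is an
    -- `n`-invariant killed by `Nc`, and `hX` applies to it.
    set x₀ := r + (1 + (c - 1) * b) • Nn • x with hx₀
    have hx0n : n • x₀ = x₀ := by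
      rw [hx₀, smul_add, hx, smul_comm n, hfix]
    have hx0c : (c - 1) • x₀ = 0 := by
      apply htf
      rw [smul_comm, ← hx2, ← mul_smul, mul_comm, hTc, zero_smul]
    have hNcx0 : Nc • x₀ = (p : S) • x₀ := by
      rw [hNc, hb, add_smul, mul_comm (p : S), mul_smul _ (p : S), add_smul, mul_comm (c - 1) b,
        mul_smul b, smul_comm (c - 1), hx0c]
      have h2p := hp.two_le
      rw [show p - 1 = p - 2 + 1 by omega, pow_succ, mul_smul, hx0c]
      simp
    obtain ⟨w, hw, hw'⟩ := hX (Nn • x - x₀) (by rw [smul_sub, hfix, hx0n])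
      (by rw [smul_sub, hx2, hNcx0, sub_self])
    obtain ⟨a, ha⟩ := h0 x₀ hx0n
    obtain ⟨w₁, hw₁⟩ := h0 w hw
    obtain ⟨q, hq⟩ := h1 (x - a - (c - 1) • w₁) (by
      rw [smul_sub, smul_sub, ← ha, hw', hw₁, smul_comm, sub_self])
    obtain ⟨s, hs⟩ := h1 ((c - 1) • a) (by rw [smul_comm, ← ha, hx0c])
    refine ⟨Submodule.Quotient.mk (a + (n - 1) • q), Submodule.Quotient.mk w₁,
      Submodule.Quotient.mk (s + (c - 1) • q), ?_, ?_⟩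
    · rw [← Submodule.Quotient.mk_smul, ← Submodule.Quotient.mk_add, ← hq]
      congr 1
      abel
    · rw [← Submodule.Quotient.mk_smul, ← Submodule.Quotient.mk_smul, smul_add, hs, smul_add,
        smul_comm (c - 1)]
  -- reduce to an element of `(n - 1) M`
  obtain ⟨x, hx, hx'⟩ := hX (Nn • m) (hfix m) (by rw [smul_comm, hm, smul_zero])
  obtain ⟨m₁, hm₁⟩ := h0 x hx
  obtain ⟨m₂, hm₂⟩ := h1 (m - (c - 1) • m₁) (by
    rw [smul_sub, hx', hm₁, smul_comm, sub_self])
  have h3 : (n - 1) • Nc • m₂ = 0 := by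
    rw [smul_comm, ← hm₂, smul_sub, hm, ← mul_smul, hTc, zero_smul, sub_zero]
  obtain ⟨w, hw⟩ := exists_smul_eq_of_norm_smul_eq_zero p hp n c hc hNL hinj hJ
    (Submodule.Quotient.mk m₂) (by
      rw [← Submodule.Quotient.mk_smul, Submodule.Quotient.mk_eq_zero, hXmem]
      rwa [sub_smul, one_smul, sub_eq_zero] at h3)
  obtain ⟨w, rfl⟩ := Submodule.Quotient.mk_surjective X w
  rw [← Submodule.Quotient.mk_smul, ← Submodule.Quotient.mk_smul, Submodule.Quotient.eq,
    hXmem] at hw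
  obtain ⟨t, -, ht⟩ := hX _ hw (by
    rw [smul_sub, smul_comm, ← mul_smul Nc (c - 1), hTc, zero_smul, h3, sub_zero])
  refine ⟨m₁ + w + t, ?_⟩
  rw [smul_add, smul_add, ← ht, ← hm₂]
  abel

end CyclicCohomology

/-! ### Eigenspaces of operators of finite order and Jordan blocks of nilpotent operators -/

section Spectral

/-- The trace of a power of an operator of finite order in terms of its eigenspaces. -/
lemma trace_pow_eq_sum {V : Type*} [AddCommGroup V] [Module ℂ V] [FiniteDimensional ℂ V]
    (f : Module.End ℂ V) (n : ℕ) (hn : 0 < n) (hf : f ^ n = 1) (j : ℕ) :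
    LinearMap.trace ℂ V (f ^ j) = ∑ ζ ∈ Polynomial.nthRootsFinset n (1 : ℂ),
      (Module.finrank ℂ (f.eigenspace ζ) : ℂ) * ζ ^ j := by
  have hss : f.IsSemisimple := by
    apply Module.End.isSemisimple_of_squarefree_aeval_eq_zero (p := Polynomial.X ^ n - 1)
    · apply Polynomial.Separable.squarefree
      rw [Polynomial.X_pow_sub_one_separable_iff]
      exact_mod_cast hn.ne'
    · simp [hf]
  have htop : ⨆ μ, f.eigenspace μ = ⊤ := by
    rw [← Module.End.iSup_maxGenEigenspace_eq_top f]
    exact iSup_congr fun μ => (hss.isFinitelySemisimple.maxGenEigenspace_eq_eigenspace μ).symm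
  have hroot : ∀ μ, f.eigenspace μ ≠ ⊥ → μ ∈ Polynomial.nthRootsFinset n (1 : ℂ) := by
    intro μ hμ
    obtain ⟨v, hv, hv0⟩ := Submodule.exists_mem_ne_zero_of_ne_bot hμ
    rw [Polynomial.mem_nthRootsFinset hn]
    have hev : f.HasEigenvector μ v := ⟨hv, hv0⟩
    have h := hev.pow_apply n
    rw [hf, Module.End.one_apply] at h
    have : (μ ^ n - 1) • v = 0 := by rw [sub_smul, one_smul, ← h, sub_self]
    rcases smul_eq_zero.1 this with h | h
    · exact sub_eq_zero.1 h
    · exact absurd h hv0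
  have hint := DirectSum.isInternal_submodule_of_iSupIndep_of_iSup_eq_top
    f.eigenspaces_iSupIndep htop
  have hfin : {μ | f.eigenspace μ ≠ ⊥}.Finite :=
    (Finset.finite_toSet _).subset fun μ hμ => hroot μ hμ
  have hmaps : ∀ μ, Set.MapsTo (f ^ j) (f.eigenspace μ) (f.eigenspace μ) := by
    intro μ v hv
    exact Module.End.mapsTo_genEigenspace_of_comm ((Commute.refl f).pow_right j) μ 1 hv
  rw [LinearMap.trace_eq_sum_trace_restrict' hint hfin hmaps]
  have hr : ∀ μ, LinearMap.trace ℂ (f.eigenspace μ) ((f ^ j).restrict (hmaps μ)) =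
      (Module.finrank ℂ (f.eigenspace μ) : ℂ) * μ ^ j := by
    intro μ
    have : (f ^ j).restrict (hmaps μ) = μ ^ j • LinearMap.id := by
      refine LinearMap.ext fun v => Subtype.ext ?_
      change (f ^ j) v = μ ^ j • (v : V)
      by_cases hv0 : (v : V) = 0
      · rw [hv0, map_zero, smul_zero]
      · exact Module.End.HasEigenvector.pow_apply ⟨v.2, hv0⟩ j
    rw [this, map_smul, LinearMap.trace_id, smul_eq_mul, mul_comm]
  rw [Finset.sum_congr rfl fun μ _ => hr μ]
  apply Finset.sum_subset
  · intro μ hμ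
    exact hroot μ (by simpa using hμ)
  · intro μ _ hμ
    have : f.eigenspace μ = ⊥ := by simpa using hμ
    rw [this]
    simp

/-- Independent submodules of `W` have total dimension at most that of `W`. -/
lemma sum_finrank_le_of_iSupIndep {K V ι : Type*} [Field K] [AddCommGroup V] [Module K V]
    [FiniteDimensional K V] (s : Finset ι) (F : ι → Submodule K V)
    (hF : iSupIndep fun i : s => F i) (W : Submodule K V) (hW : ∀ i ∈ s, F i ≤ W) :
    ∑ i ∈ s, Module.finrank K (F i) ≤ Module.finrank K W := by
  classical
  rw [← Finset.sum_coe_sort, ← Module.finrank_directSum]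
  have h := hF.dfinsupp_lsum_injective
  refine LinearMap.finrank_le_finrank_of_injective
    (f := (DirectSum.coeLinearMap fun i : s => F i).codRestrict W fun x => ?_) ?_
  · exact (iSup_le fun i : s => hW i i.2) (by
      rw [← DirectSum.range_coeLinearMap]; exact ⟨x, rfl⟩)
  · intro x y hxy
    exact h (congrArg Subtype.val hxy)

/-- Rank–nullity for the restriction of `s` to the range of a power of `s`. -/
lemma finrank_range_pow_eq {K V : Type*} [Field K] [AddCommGroup V] [Module K V]
    [FiniteDimensional K V] (s : Module.End K V) (i : ℕ) :
    Module.finrank K (LinearMap.range (s ^ i)) = Module.finrank K (LinearMap.range (s ^ (i + 1)))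
      + Module.finrank K (LinearMap.ker s ⊓ LinearMap.range (s ^ i) : Submodule K V) := by
  have h := LinearMap.finrank_range_add_finrank_ker (s.domRestrict (LinearMap.range (s ^ i)))
  rw [← h]
  congr 1
  · have : LinearMap.range (s.domRestrict (LinearMap.range (s ^ i))) =
        LinearMap.range (s ^ (i + 1)) := by
      ext x
      constructor
      · rintro ⟨⟨_, y, rfl⟩, rfl⟩
        exact ⟨y, by rw [pow_succ']; rfl⟩
      · rintro ⟨y, rfl⟩
        exact ⟨⟨(s ^ i) y, y, rfl⟩, by rw [pow_succ']; rfl⟩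
    rw [this]
  · have : LinearMap.ker s ⊓ LinearMap.range (s ^ i) =
        (LinearMap.ker (s.domRestrict (LinearMap.range (s ^ i)))).map
          (LinearMap.range (s ^ i)).subtype := by
      ext x
      constructor
      · rintro ⟨hx, hx'⟩
        exact ⟨⟨x, hx'⟩, hx, rfl⟩
      · rintro ⟨y, hy, rfl⟩
        exact ⟨hy, y.2⟩
    rw [this, Submodule.finrank_map_subtype_eq]

/-- The `i`-th summand counts the Jordan blocks of size greater than `i`, so a block of size `l` is
counted `l` times. -/
lemma finrank_eq_sum_ker_inf_range {K V : Type*} [Field K] [AddCommGroup V] [Module K V]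
    [FiniteDimensional K V] (s : Module.End K V) (m : ℕ) (hs : s ^ m = 0) :
    Module.finrank K V = ∑ i ∈ Finset.range m,
      Module.finrank K (LinearMap.ker s ⊓ LinearMap.range (s ^ i) : Submodule K V) := by
  have h : ∀ m, Module.finrank K V = Module.finrank K (LinearMap.range (s ^ m)) +
      ∑ i ∈ Finset.range m,
        Module.finrank K (LinearMap.ker s ⊓ LinearMap.range (s ^ i) : Submodule K V) := by
    intro m
    induction m with
    | zero =>
      rw [pow_zero, Module.End.one_eq_id, LinearMap.range_id, finrank_top]
      simp
    | succ m ih =>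
      rw [Finset.sum_range_succ, ih, finrank_range_pow_eq s m]
      ring
  rw [h m, hs]
  simp

lemma range_pow_le_range_pow {K V : Type*} [Field K] [AddCommGroup V] [Module K V]
    (s : Module.End K V) {i j : ℕ} (hij : i ≤ j) :
    LinearMap.range (s ^ j) ≤ LinearMap.range (s ^ i) := by
  rintro _ ⟨y, rfl⟩
  exact ⟨(s ^ (j - i)) y, by rw [← Module.End.mul_apply, ← pow_add, Nat.add_sub_cancel' hij]⟩

/-- If all Jordan blocks of a nilpotent `s` have size `m`, the dimension is `m` times the number
of blocks. -/
lemma mul_finrank_ker_eq {K V : Type*} [Field K] [AddCommGroup V] [Module K V]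
    [FiniteDimensional K V] (s : Module.End K V) (m : ℕ) (hs : s ^ m = 0)
    (h : LinearMap.ker s ≤ LinearMap.range (s ^ (m - 1))) :
    m * Module.finrank K (LinearMap.ker s) = Module.finrank K V := by
  rw [finrank_eq_sum_ker_inf_range s m hs, Finset.sum_congr rfl (g := fun _ =>
    Module.finrank K (LinearMap.ker s))]
  · simp
  · intro i hi
    rw [inf_eq_left.2 (h.trans (range_pow_le_range_pow s (by
      have := Finset.mem_range.1 hi; omega)))]

/-- A nilpotent operator with few Jordan blocks has only blocks of maximal size. -/
lemma ker_le_range_of_mul_finrank_le {K V : Type*} [Field K] [AddCommGroup V] [Module K V]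
    [FiniteDimensional K V] (s : Module.End K V) (m : ℕ) (hm : 0 < m) (hs : s ^ m = 0)
    (h : m * Module.finrank K (LinearMap.ker s) ≤ Module.finrank K V) :
    LinearMap.ker s ≤ LinearMap.range (s ^ (m - 1)) := by
  have hle : ∀ i ∈ Finset.range m,
      Module.finrank K (LinearMap.ker s ⊓ LinearMap.range (s ^ i) : Submodule K V) ≤
      Module.finrank K (LinearMap.ker s) := fun i _ => Submodule.finrank_mono inf_le_left
  have heq : ∑ i ∈ Finset.range m,
      Module.finrank K (LinearMap.ker s ⊓ LinearMap.range (s ^ i) : Submodule K V) =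
      ∑ i ∈ Finset.range m, Module.finrank K (LinearMap.ker s) := by
    refine le_antisymm (Finset.sum_le_sum hle) ?_
    rw [← finrank_eq_sum_ker_inf_range s m hs]
    simpa using h
  have := (Finset.sum_eq_sum_iff_of_le hle).1 heq (m - 1) (by simp; omega)
  exact inf_eq_left.1 (Submodule.eq_of_le_of_finrank_eq inf_le_left this)

/-- For `h ^ p ^ a = 1` over characteristic `p`: if all blocks of `t ^ p ^ (a - 1)` have size `p`
then all blocks of `t` have size `p ^ a`. -/
lemma ker_le_range_pow_of_pow {K V : Type*} [Field K] [AddCommGroup V] [Module K V]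
    (t : Module.End K V) (p Q : ℕ) (hp : 2 ≤ p) (hQ : 0 < Q)
    (h : LinearMap.ker (t ^ Q) ≤ LinearMap.range (t ^ (Q * (p - 1)))) :
    LinearMap.ker t ≤ LinearMap.range (t ^ (Q * p - 1)) := by
  -- For `t ^ Q` with full blocks of size `p`, the kernel of the `i`-th power lies in the image of
  -- the power `p - i`. The case `i = p - 1` is what allows division by `t ^ Q` below.
  have hlift : ∀ i < p, LinearMap.ker (t ^ (Q * i)) ≤ LinearMap.range (t ^ (Q * (p - i))) := by
    intro i
    induction i with
    | zero =>
      intro _ x hx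
      have hx0 : x = 0 := by simpa using hx
      subst hx0
      exact zero_mem _
    | succ i ih =>
      intro hi x hx
      have hx1 : (t ^ (Q * i)) x ∈ LinearMap.ker (t ^ Q) := by
        rw [LinearMap.mem_ker, ← Module.End.mul_apply, ← pow_add]
        rw [LinearMap.mem_ker, show Q * (i + 1) = Q + Q * i by ring] at hx
        exact hx
      obtain ⟨y, hy⟩ := h hx1
      have hx2 : x - (t ^ (Q * (p - 1 - i))) y ∈ LinearMap.ker (t ^ (Q * i)) := by
        rw [LinearMap.mem_ker, map_sub, ← Module.End.mul_apply, ← pow_add, ← Nat.mul_add,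
          show i + (p - 1 - i) = p - 1 by omega, hy, sub_self]
      obtain ⟨z, hz⟩ := ih (by omega) hx2
      refine ⟨y + (t ^ Q) z, ?_⟩
      rw [map_add, ← Module.End.mul_apply, ← pow_add, show p - (i + 1) = p - 1 - i by omega,
        show Q * (p - 1 - i) + Q = Q * (p - i) by
          rw [show p - i = p - 1 - i + 1 by omega]; ring, hz]
      abel
  have hker : LinearMap.ker t ≤ LinearMap.ker (t ^ Q) := by
    intro x hx
    rw [LinearMap.mem_ker] at hx ⊢
    rw [show Q = Q - 1 + 1 by omega, pow_succ, Module.End.mul_apply, hx, map_zero]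
  intro x hx
  obtain ⟨y, rfl⟩ := h (hker hx)
  have h1 : t y ∈ LinearMap.ker (t ^ (Q * (p - 1))) := by
    rw [LinearMap.mem_ker, ← Module.End.mul_apply, ← pow_succ, pow_succ', Module.End.mul_apply]
    exact hx
  obtain ⟨y₁, hy₁⟩ := hlift (p - 1) (by omega) h1
  rw [show Q * (p - (p - 1)) = Q by rw [show p - (p - 1) = 1 by omega, mul_one]] at hy₁
  have h2 : y - (t ^ (Q - 1)) y₁ ∈ LinearMap.ker t := by
    rw [LinearMap.mem_ker, map_sub, ← Module.End.mul_apply t, ← pow_succ',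
      show Q - 1 + 1 = Q by omega, hy₁, sub_self]
  refine ⟨y₁, ?_⟩
  have h3 : (t ^ (Q * (p - 1))) (y - (t ^ (Q - 1)) y₁) = 0 := by
    have hpos : 0 < Q * (p - 1) := Nat.mul_pos hQ (by omega)
    rw [show Q * (p - 1) = Q * (p - 1) - 1 + 1 by omega, pow_succ, Module.End.mul_apply,
      LinearMap.mem_ker.1 h2, map_zero]
  rw [map_sub, sub_eq_zero, ← Module.End.mul_apply, ← pow_add] at h3
  rw [h3]
  congr 2
  have hpos : 0 < Q * (p - 1) := Nat.mul_pos hQ (by omega)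
  have : Q * p = Q * (p - 1) + Q := by
    conv_lhs => rw [show p = p - 1 + 1 by omega]
    ring
  omega

end Spectral

/-! ### Ranks and kernels under reduction from a valuation ring of ℂ -/

section ValuationReduction

open IsLocalRing

/-- There is a valuation ring of `ℂ` whose residue field has characteristic `p`. -/
lemma exists_valuationSubring_residue_charP (p : ℕ) (hp : p.Prime) :
    ∃ R : ValuationSubring ℂ, CharP (ResidueField R) p := by
  obtain ⟨R, -, hR⟩ := Ideal.image_subset_nonunits_valuationSubring
    (A := (Int.castRingHom ℂ).range) (Ideal.span {(p : (Int.castRingHom ℂ).range)}) (by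
      rw [Ne, Ideal.span_singleton_eq_top]
      intro h
      obtain ⟨⟨_, b, rfl⟩, hb⟩ := h.exists_right_inv
      have hb' : ((p * b : ℤ) : ℂ) = 1 := by
        have := congrArg Subtype.val hb
        simpa using this
      have hb2 : (p : ℤ) * b = 1 := by exact_mod_cast hb'
      have := Int.isUnit_iff_natAbs_eq.1 (IsUnit.of_mul_eq_one _ hb2)
      simp only [Int.natAbs_natCast] at this
      exact hp.one_lt.ne' this)
  refine ⟨R, ?_⟩
  have hpR : (p : ℂ) ∈ R.nonunits := hR ⟨(p : (Int.castRingHom ℂ).range),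
    Ideal.mem_span_singleton_self _, by simp⟩
  have h0 : ((p : ℕ) : ResidueField R) = 0 := by
    have h1 : residue R (p : R) = 0 := by
      rw [residue_eq_zero_iff]
      rw [← SetLike.mem_coe, ← R.image_maximalIdeal] at hpR
      obtain ⟨x, hx, hx'⟩ := hpR
      have : x = (p : R) := Subtype.ext (by simpa using hx')
      rwa [← this]
    simpa using h1
  exact (CharP.charP_iff_prime_eq_zero hp).2 h0

variable (R : ValuationSubring ℂ)

/-- Vectors over a valuation ring that are independent over the residue field are independent
over the field of fractions. -/
lemma linearIndependent_of_residue {κ ι : Type*} [Finite κ] (v : κ → ι → R)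
    (hv : LinearIndependent (ResidueField R) fun i j => residue R (v i j)) :
    LinearIndependent ℂ fun i j => (v i j : ℂ) := by
  classical
  have := Fintype.ofFinite κ
  rw [Fintype.linearIndependent_iff] at hv ⊢
  intro c hc
  by_contra! hne
  obtain ⟨i₁, hi₁⟩ := hne
  -- Dividing a relation by its coefficient of largest valuation makes it integral with one
  -- coefficient 1, so its reduction is still nontrivial.
  obtain ⟨i₀, -, hi₀⟩ := Finset.exists_max_image Finset.univ (fun i => R.valuation (c i))
    ⟨i₁, Finset.mem_univ _⟩
  have hc0 : c i₀ ≠ 0 := by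
    intro h
    have := hi₀ i₁ (Finset.mem_univ _)
    rw [h, map_zero, le_zero_iff, map_eq_zero] at this
    exact hi₁ this
  have hmem : ∀ i, c i / c i₀ ∈ R := by
    intro i
    rw [← R.valuation_le_one_iff, map_div₀]
    exact div_le_one_of_le₀ (hi₀ i (Finset.mem_univ _)) zero_le
  let d : κ → R := fun i => ⟨c i / c i₀, hmem i⟩
  have hd : ∀ j, ∑ i, d i * v i j = 0 := by
    intro j
    apply Subtype.ext
    have := congrFun hc j
    simp only [Finset.sum_apply, Pi.smul_apply, smul_eq_mul, Pi.zero_apply] at this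
    push_cast
    simp only [d]
    rw [show ∑ i, c i / c i₀ * (v i j : ℂ) = (∑ i, c i * (v i j : ℂ)) / c i₀ by
      rw [Finset.sum_div]; exact Finset.sum_congr rfl fun i _ => by ring, this, zero_div]
  have h1 := hv (fun i => residue R (d i)) (by
    ext j
    have := congrArg (residue R) (hd j)
    simpa using this) i₀
  have h2 : d i₀ = 1 := Subtype.ext (div_self hc0)
  rw [h2, map_one] at h1
  exact one_ne_zero h1

/-- The rank of a matrix cannot grow under reduction. -/
lemma rank_residue_le {ι κ : Type*} [Fintype ι] [Fintype κ] (B : Matrix ι κ R) :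
    (B.map (residue R)).rank ≤ (B.map (algebraMap R ℂ)).rank := by
  classical
  -- A basis of the column space among the reduced columns comes from columns that are independent
  -- over ℂ.
  obtain ⟨b, hb, hspan, hli⟩ := exists_linearIndependent (ResidueField R)
    (Set.range (B.map (residue R)).col)
  choose f hf using fun x : b => hb x.2
  have hbfin : Finite b := (Set.finite_range (B.map (residue R)).col).subset hb
  have := Fintype.ofFinite b
  have hli' : LinearIndependent (ResidueField R)
      fun (x : b) (i : ι) => residue R (B i (f x)) := by
    convert! hli using 2 with x
    exact hf x
  have h := linearIndependent_of_residue R (fun (x : b) (i : ι) => B i (f x)) hli'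
  rw [Matrix.rank_eq_finrank_span_cols, Matrix.rank_eq_finrank_span_cols, ← hspan,
    finrank_span_set_eq_card hli, Set.toFinset_card, ← finrank_span_eq_card h]
  apply Submodule.finrank_mono
  apply Submodule.span_mono
  rintro _ ⟨x, rfl⟩
  exact ⟨f x, rfl⟩

/-- The kernel of a square matrix cannot shrink under reduction. -/
lemma finrank_ker_le_finrank_ker_residue {ι : Type*} [Fintype ι] [DecidableEq ι]
    (B : Matrix ι ι R) :
    Module.finrank ℂ (LinearMap.ker (Matrix.toLin' (B.map (algebraMap R ℂ)))) ≤
      Module.finrank (ResidueField R) (LinearMap.ker (Matrix.toLin' (B.map (residue R)))) := by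
  have h1 := LinearMap.finrank_range_add_finrank_ker (Matrix.toLin' (B.map (algebraMap R ℂ)))
  have h2 := LinearMap.finrank_range_add_finrank_ker (Matrix.toLin' (B.map (residue R)))
  have h3 := rank_residue_le R B
  rw [Matrix.rank, Matrix.rank, ← Matrix.toLin'_apply', ← Matrix.toLin'_apply'] at h3
  rw [Module.finrank_fintype_fun_eq_card] at h1 h2
  omega

/-- If every vector over the residue field killed by `B` lifts to a vector over the valuation ring
killed by `B`, then the kernel does not grow under reduction. -/
lemma finrank_ker_residue_le_finrank_ker {ι : Type*} [Fintype ι] [DecidableEq ι]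
    (B : Matrix ι ι R)
    (hB : ∀ x : ι → ResidueField R, (B.map (residue R)).mulVec x = 0 →
      ∃ y : ι → R, B.mulVec y = 0 ∧ ∀ i, residue R (y i) = x i) :
    Module.finrank (ResidueField R) (LinearMap.ker (Matrix.toLin' (B.map (residue R)))) ≤
      Module.finrank ℂ (LinearMap.ker (Matrix.toLin' (B.map (algebraMap R ℂ)))) := by
  let e := Module.finBasis (ResidueField R) (LinearMap.ker (Matrix.toLin' (B.map (residue R))))
  choose y hy hy' using fun i => hB (e i) (by
    rw [← Matrix.toLin'_apply]; exact (e i).2)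
  have hli : LinearIndependent ℂ fun i j => (y i j : ℂ) := by
    apply linearIndependent_of_residue
    have := e.linearIndependent.map' (Submodule.subtype _) (Submodule.ker_subtype _)
    convert! this using 2 with i
    exact funext (hy' i)
  have hli' : LinearIndependent ℂ fun i => (⟨fun j => (y i j : ℂ), by
      have := congrArg (fun v : ι → R => fun j => (v j : ℂ)) (hy i)
      rw [LinearMap.mem_ker, Matrix.toLin'_apply]
      ext j
      have := congrFun this j
      simpa [Matrix.mulVec, dotProduct] using this⟩ :
      LinearMap.ker (Matrix.toLin' (B.map (algebraMap R ℂ)))) := by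
    rw [← LinearMap.linearIndependent_iff (Submodule.subtype _) (Submodule.ker_subtype _)]
    exact hli
  simpa using hli'.fintype_card_le_finrank

end ValuationReduction

/-! ### Free action in characteristic p forces trace zero -/

section TraceVanishing

open IsLocalRing Polynomial

lemma mem_valuationSubring_of_pow_eq_one (R : ValuationSubring ℂ) {ζ : ℂ} {n : ℕ} (hn : 0 < n)
    (h : ζ ^ n = 1) : ζ ∈ R := by
  rw [← R.valuation_le_one_iff]
  by_contra! hlt
  have h1 := one_lt_pow₀ hlt hn.ne'
  rw [← map_pow, h, map_one] at h1
  exact lt_irrefl _ h1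

/-- Reduction is injective on roots of unity of order prime to the residue characteristic. -/
lemma eq_one_of_residue_eq_one (R : ValuationSubring ℂ) (p : ℕ) [CharP (ResidueField R) p]
    {q : ℕ} (hq : ¬ p ∣ q) (ω : R) (hω : ω ^ q = 1) (h : residue R ω = 1) : ω = 1 := by
  by_contra hne
  have h1 : (∑ j ∈ Finset.range q, ω ^ j) * (ω - 1) = 0 := by rw [geom_sum_mul, hω, sub_self]
  have h2 := (mul_eq_zero.1 h1).resolve_right (sub_ne_zero.2 hne)
  have h3 := congrArg (residue R) h2
  rw [map_sum, map_zero] at h3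
  simp only [map_pow, h, one_pow, Finset.sum_const, Finset.card_range, nsmul_eq_mul,
    mul_one] at h3
  exact hq ((CharP.cast_eq_zero_iff (ResidueField R) p q).1 h3)

/-- By coprimality a root of unity factors uniquely into its two parts. This separates the `p`-part,
which reduces to 1, from the part on which reduction is injective. -/
lemma sum_nthRootsFinset_mul {M : Type*} [AddCommMonoid M] (a q : ℕ) (ha : 0 < a) (hq : 0 < q)
    (hc : a.Coprime q) (F : ℂ → M) :
    ∑ ζ ∈ nthRootsFinset (a * q) (1 : ℂ), F ζ =
      ∑ η ∈ nthRootsFinset q (1 : ℂ), ∑ ξ ∈ nthRootsFinset a (1 : ℂ), F (η * ξ) := by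
  classical
  have haq : 0 < a * q := Nat.mul_pos ha hq
  have hinj : Set.InjOn (fun x : ℂ × ℂ => x.1 * x.2)
      (nthRootsFinset q (1 : ℂ) ×ˢ nthRootsFinset a (1 : ℂ) : Finset (ℂ × ℂ)) := by
    rintro ⟨η, ξ⟩ h1 ⟨η', ξ'⟩ h2 h
    simp only [Finset.coe_product, Set.mem_prod, Finset.mem_coe, mem_nthRootsFinset hq,
      mem_nthRootsFinset ha] at h1 h2 h
    have hη' : η' ≠ 0 := by rintro rfl; simp [hq.ne'] at h2
    have hξ : ξ ≠ 0 := by rintro rfl; simp [ha.ne'] at h1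
    have h3 : η / η' = ξ' / ξ := by field_simp; linear_combination h
    have h4 : (η / η') ^ q = 1 := by rw [div_pow, h1.1, h2.1, div_one]
    have h5 : (η / η') ^ a = 1 := by rw [h3, div_pow, h1.2, h2.2, div_one]
    have h6 : η / η' = 1 := by simpa [hc] using pow_gcd_eq_one.2 ⟨h5, h4⟩
    have h7 : η = η' := by rwa [div_eq_one_iff_eq hη'] at h6
    have h8 : ξ' = ξ := by rw [h6] at h3; exact ((div_eq_one_iff_eq hξ).1 h3.symm)
    rw [h7, h8]
  have himg : (nthRootsFinset q (1 : ℂ) ×ˢ nthRootsFinset a (1 : ℂ)).image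
      (fun x : ℂ × ℂ => x.1 * x.2) = nthRootsFinset (a * q) (1 : ℂ) := by
    apply Finset.eq_of_subset_of_card_le
    · intro x hx
      obtain ⟨⟨η, ξ⟩, h1, rfl⟩ := Finset.mem_image.1 hx
      simp only [Finset.mem_product, mem_nthRootsFinset hq, mem_nthRootsFinset ha] at h1
      rw [mem_nthRootsFinset haq, mul_pow, pow_mul', h1.1, pow_mul, h1.2, one_pow, one_pow, one_mul]
    · rw [Finset.card_image_of_injOn hinj, Finset.card_product,
        (Complex.isPrimitiveRoot_exp _ haq.ne').card_nthRootsFinset,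
        (Complex.isPrimitiveRoot_exp _ ha.ne').card_nthRootsFinset,
        (Complex.isPrimitiveRoot_exp _ hq.ne').card_nthRootsFinset, mul_comm]
  rw [← himg, Finset.sum_image hinj, Finset.sum_product]

lemma sum_nthRootsFinset_eq_zero (n : ℕ) (hn : 1 < n) : ∑ ξ ∈ nthRootsFinset n (1 : ℂ), ξ = 0 := by
  have hω := Complex.isPrimitiveRoot_exp n (by omega)
  set ω := Complex.exp (2 * Real.pi * Complex.I / n)
  have hω0 : ω ≠ 0 := hω.ne_zero (by omega)
  have h : ∑ ξ ∈ nthRootsFinset n (1 : ℂ), ξ = ω * ∑ ξ ∈ nthRootsFinset n (1 : ℂ), ξ := by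
    rw [Finset.mul_sum]
    symm
    refine Finset.sum_bij (fun ξ _ => ω * ξ) ?_ ?_ ?_ fun _ _ => rfl
    · intro ξ hξ
      rw [mem_nthRootsFinset (by omega)] at hξ ⊢
      rw [mul_pow, hξ, hω.pow_eq_one, one_mul]
    · intro a _ b _ hab
      exact mul_left_cancel₀ hω0 hab
    · intro ξ hξ
      rw [mem_nthRootsFinset (by omega)] at hξ
      refine ⟨ω⁻¹ * ξ, ?_, mul_inv_cancel_left₀ hω0 ξ⟩
      rw [mem_nthRootsFinset (by omega), mul_pow, inv_pow, hω.pow_eq_one, hξ, inv_one, one_mul]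
  have h1 : (1 - ω) * ∑ ξ ∈ nthRootsFinset n (1 : ℂ), ξ = 0 := by
    rw [sub_mul, one_mul, sub_eq_zero]; exact h
  exact (mul_eq_zero.1 h1).resolve_left (sub_ne_zero.2 (hω.ne_one hn).symm)

lemma toLin'_map_sub_scalar {ι S₁ S₂ : Type*} [Fintype ι] [DecidableEq ι] [CommRing S₁]
    [CommRing S₂] (φ : S₁ →+* S₂) (A : Matrix ι ι ℤ) (z : S₁) :
    Matrix.toLin' ((A.map (Int.cast : ℤ → S₁) - Matrix.scalar ι z).map φ) =
      Matrix.toLin' (A.map (Int.cast : ℤ → S₂)) - algebraMap S₂ (Module.End S₂ (ι → S₂)) (φ z) := by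
  have : (A.map (Int.cast : ℤ → S₁) - Matrix.scalar ι z).map φ =
      A.map (Int.cast : ℤ → S₂) - Matrix.scalar ι (φ z) := by
    ext i j
    simp [Matrix.diagonal_apply, apply_ite φ]
  rw [this, map_sub]
  congr 1
  refine LinearMap.ext fun v => ?_
  ext i
  simp [Matrix.mulVec_diagonal]

/-- An integral matrix of finite order `n` has trace zero if, over a field of characteristic `p`,
its power of order `p` acts freely. -/
theorem trace_eq_zero_of_ker_le_range (p : ℕ) (hp : p.Prime) (R : ValuationSubring ℂ)
    [CharP (ResidueField R) p] {ι : Type*} [Fintype ι] [DecidableEq ι] (A : Matrix ι ι ℤ) (n : ℕ)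
    (hn : 0 < n) (hpn : p ∣ n) (hA : A ^ n = 1)
    (hz : LinearMap.ker (Matrix.toLin' (A.map (Int.cast : ℤ → ResidueField R)) ^ (n / p) - 1) ≤
      LinearMap.range ((Matrix.toLin' (A.map (Int.cast : ℤ → ResidueField R)) ^ (n / p) - 1)
        ^ (p - 1))) :
    A.trace = 0 := by
  classical
  have := Fact.mk hp
  set g : Module.End (ResidueField R) (ι → ResidueField R) := Matrix.toLin' (A.map (Int.cast : ℤ → ResidueField R)) with hg
  set f : Module.End ℂ (ι → ℂ) := Matrix.toLin' (A.map (Int.cast : ℤ → ℂ)) with hf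
  have hfn : f ^ n = 1 := by
    have := congrArg (fun B => Matrix.toLin' ((Int.castRingHom ℂ).mapMatrix B)) hA
    simp only [map_pow, map_one, Matrix.toLin'_pow, Matrix.toLin'_one] at this
    exact this
  have hgn : g ^ n = 1 := by
    have := congrArg (fun B => Matrix.toLin' ((Int.castRingHom (ResidueField R)).mapMatrix B)) hA
    simp only [map_pow, map_one, Matrix.toLin'_pow, Matrix.toLin'_one] at this
    exact this
  obtain ⟨a, q, hq, hnaq⟩ := Nat.exists_eq_pow_mul_and_not_dvd hn.ne' p hp.ne_one
  have ha : a ≠ 0 := by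
    rintro rfl
    rw [pow_zero, one_mul] at hnaq
    exact hq (hnaq ▸ hpn)
  have hq0 : 0 < q := Nat.pos_of_ne_zero (by rintro rfl; exact hq (dvd_zero p))
  have hpa : 0 < p ^ a := pow_pos hp.pos a
  -- For empty `ι` the endomorphism ring is trivial and does not have characteristic `p`.
  have hchar : CharP (Module.End (ResidueField R) (ι → ResidueField R)) p ∨ IsEmpty ι := by
    rcases isEmpty_or_nonempty ι with h | h
    · exact Or.inr h
    · exact Or.inl (charP_of_injective_algebraMap
        (algebraMap (ResidueField R) _).injective p)
  rcases hchar with hchar | hempty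
  swap
  · simp [Matrix.trace]
  -- dimension count over the residue field
  set t := g ^ q - 1 with ht
  have htp : ∀ i, t ^ p ^ i = g ^ (q * p ^ i) - 1 := by
    intro i
    rw [ht, sub_pow_char_pow_of_commute _ _ (Commute.one_right _), one_pow, pow_mul]
  have hnp : n / p = q * p ^ (a - 1) := by
    rw [hnaq, show a = a - 1 + 1 by omega, pow_succ]
    rw [show p ^ (a - 1) * p * q = q * p ^ (a - 1) * p by ring, Nat.mul_div_cancel _ hp.pos]
    simp
  rw [hnp, ← htp, ← pow_mul] at hz
  have hker := ker_le_range_pow_of_pow t p (p ^ (a - 1)) hp.two_le (pow_pos hp.pos _) hz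
  rw [← pow_succ, show a - 1 + 1 = a by omega] at hker
  have htn : t ^ p ^ a = 0 := by rw [htp, mul_comm, ← hnaq, hgn, sub_self]
  have hD := mul_finrank_ker_eq t (p ^ a) htn hker
  rw [Module.finrank_fintype_fun_eq_card] at hD
  -- reduction of roots of unity
  let red : ℂ → ResidueField R := fun ζ => if h : ζ ∈ R then residue R ⟨ζ, h⟩ else 0
  have hredmul : ∀ x y : ℂ, x ∈ R → y ∈ R → red (x * y) = red x * red y := by
    intro x y hx hy
    simp only [red, hx, hy, R.mul_mem x y hx hy, dif_pos]
    rw [← map_mul]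
    rfl
  have hredone : red 1 = 1 := by
    simp only [red, R.one_mem, dif_pos]
    exact map_one (residue R)
  have hredpow : ∀ (x : ℂ) (m : ℕ), x ∈ R → red (x ^ m) = red x ^ m := by
    intro x m hx
    induction m with
    | zero => simp [hredone]
    | succ m ih => rw [pow_succ, hredmul _ _ (pow_mem hx m) hx, ih, pow_succ]
  have hb : ∀ ζ : ℂ, ζ ∈ R → Module.finrank ℂ (f.eigenspace ζ) ≤
      Module.finrank (ResidueField R) (g.eigenspace (red ζ)) := by
    intro ζ hζ
    have h := finrank_ker_le_finrank_ker_residue R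
      (A.map (Int.cast : ℤ → R) - Matrix.scalar ι (⟨ζ, hζ⟩ : R))
    rw [toLin'_map_sub_scalar, toLin'_map_sub_scalar] at h
    have h1 : red ζ = residue R ⟨ζ, hζ⟩ := by simp only [red, hζ, dif_pos]
    rw [h1, Module.End.eigenspace_def, Module.End.eigenspace_def]
    exact h
  have hmemq : ∀ η ∈ nthRootsFinset q (1 : ℂ), η ∈ R := fun η hη =>
    mem_valuationSubring_of_pow_eq_one R hq0 ((mem_nthRootsFinset hq0 _).1 hη)
  have hmema : ∀ ξ ∈ nthRootsFinset (p ^ a) (1 : ℂ), ξ ∈ R := fun ξ hξ =>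
    mem_valuationSubring_of_pow_eq_one R hpa ((mem_nthRootsFinset hpa _).1 hξ)
  have hredξ : ∀ ξ ∈ nthRootsFinset (p ^ a) (1 : ℂ), red ξ = 1 := by
    intro ξ hξ
    have h1 : red ξ ^ p ^ a = 1 := by
      rw [← hredpow _ _ (hmema ξ hξ), (mem_nthRootsFinset hpa _).1 hξ, hredone]
    have h2 : (red ξ - 1) ^ p ^ a = 0 := by rw [sub_pow_char_pow, h1, one_pow, sub_self]
    exact sub_eq_zero.1 (eq_zero_of_pow_eq_zero h2)
  have hinj : ∀ η ∈ nthRootsFinset q (1 : ℂ), ∀ η' ∈ nthRootsFinset q (1 : ℂ),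
      red η = red η' → η = η' := by
    intro η hη η' hη' h
    have h1 := (mem_nthRootsFinset hq0 _).1 hη
    have h1' := (mem_nthRootsFinset hq0 _).1 hη'
    have hη'0 : η' ≠ 0 := by rintro rfl; simp [hq0.ne'] at h1'
    have h2 : (η / η') ^ q = 1 := by rw [div_pow, h1, h1', div_one]
    have hmem := mem_valuationSubring_of_pow_eq_one R hq0 h2
    have h3 : red (η / η') * red η' = red η' := by
      rw [← hredmul _ _ hmem (hmemq _ hη'), div_mul_cancel₀ _ hη'0, h]
    have h4 : red η' ≠ 0 := by
      intro h0
      have := hredpow η' q (hmemq _ hη')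
      rw [h1', hredone, h0, zero_pow hq0.ne'] at this
      exact one_ne_zero this
    have h5 : red (η / η') = 1 := mul_right_cancel₀ h4 (by rw [h3, one_mul])
    have h6 := eq_one_of_residue_eq_one R p hq ⟨η / η', hmem⟩ (Subtype.ext h2) (by
      simpa only [red, hmem, dif_pos] using h5)
    exact (div_eq_one_iff_eq hη'0).1 (congrArg Subtype.val h6)
  -- comparison of multiplicities
  have hκ : ∑ η ∈ nthRootsFinset q (1 : ℂ), Module.finrank (ResidueField R)
      (g.eigenspace (red η)) ≤ Module.finrank (ResidueField R) (LinearMap.ker t) := by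
    apply sum_finrank_le_of_iSupIndep _ fun η => g.eigenspace (red η)
    · exact g.eigenspaces_iSupIndep.comp
        (f := fun η : nthRootsFinset q (1 : ℂ) => red η)
        fun η η' h => Subtype.ext (hinj _ η.2 _ η'.2 h)
    · intro η hη x hx
      rw [LinearMap.mem_ker, ht, LinearMap.sub_apply, Module.End.one_apply, sub_eq_zero]
      by_cases hx0 : x = 0
      · rw [hx0, map_zero]
      · rw [Module.End.HasEigenvector.pow_apply ⟨hx, hx0⟩ q, ← hredpow _ _ (hmemq η hη),
          (mem_nthRootsFinset hq0 _).1 hη, hredone, one_smul]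
  have htrace := trace_pow_eq_sum f n hn hfn
  simp only [hnaq] at htrace
  have hcop : (p ^ a).Coprime q := ((Nat.Prime.coprime_iff_not_dvd hp).2 hq).pow_left a
  have hDC : (Fintype.card ι : ℕ) = ∑ η ∈ nthRootsFinset q (1 : ℂ),
      ∑ ξ ∈ nthRootsFinset (p ^ a) (1 : ℂ), Module.finrank ℂ (f.eigenspace (η * ξ)) := by
    have h := htrace 0
    rw [pow_zero, Module.End.one_eq_id, LinearMap.trace_id,
      Module.finrank_fintype_fun_eq_card] at h
    rw [← sum_nthRootsFinset_mul (p ^ a) q hpa hq0 hcop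
      fun ζ => Module.finrank ℂ (f.eigenspace ζ)]
    simp only [pow_zero, mul_one] at h
    exact_mod_cast h
  have hle : ∀ η ∈ nthRootsFinset q (1 : ℂ), ∀ ξ ∈ nthRootsFinset (p ^ a) (1 : ℂ),
      Module.finrank ℂ (f.eigenspace (η * ξ)) ≤
        Module.finrank (ResidueField R) (g.eigenspace (red η)) := by
    intro η hη ξ hξ
    have := hb (η * ξ) (R.mul_mem _ _ (hmemq η hη) (hmema ξ hξ))
    rwa [hredmul _ _ (hmemq η hη) (hmema ξ hξ), hredξ ξ hξ, mul_one] at this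
  have hcard : (nthRootsFinset (p ^ a) (1 : ℂ)).card = p ^ a :=
    (Complex.isPrimitiveRoot_exp _ hpa.ne').card_nthRootsFinset
  -- This closes the chain |ι| = Σ mult(ηξ) ≤ p^a Σ dim(eigenspace of red η) ≤ p^a dim ker t = |ι|.
  -- Equality throughout makes the multiplicity of `η * ξ` independent of `ξ`.
  have hsumle : ∑ η ∈ nthRootsFinset q (1 : ℂ), ∑ ξ ∈ nthRootsFinset (p ^ a) (1 : ℂ),
      Module.finrank (ResidueField R) (g.eigenspace (red η)) ≤ Fintype.card ι := by
    simp only [Finset.sum_const, hcard, smul_eq_mul]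
    rw [← Finset.mul_sum, ← hD]
    exact Nat.mul_le_mul_left _ hκ
  have heq1 := (Finset.sum_eq_sum_iff_of_le fun η hη => Finset.sum_le_sum (hle η hη)).1
    (le_antisymm (Finset.sum_le_sum fun η hη => Finset.sum_le_sum (hle η hη)) (hDC ▸ hsumle))
  have heq : ∀ η ∈ nthRootsFinset q (1 : ℂ), ∀ ξ ∈ nthRootsFinset (p ^ a) (1 : ℂ),
      Module.finrank ℂ (f.eigenspace (η * ξ)) =
        Module.finrank (ResidueField R) (g.eigenspace (red η)) := fun η hη =>
    (Finset.sum_eq_sum_iff_of_le (hle η hη)).1 (heq1 η hη)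
  have hfinal : LinearMap.trace ℂ (ι → ℂ) f = 0 := by
    have h := htrace 1
    rw [pow_one] at h
    rw [h, sum_nthRootsFinset_mul (p ^ a) q hpa hq0 hcop]
    apply Finset.sum_eq_zero
    intro η hη
    have h1 : ∀ ξ ∈ nthRootsFinset (p ^ a) (1 : ℂ),
        (Module.finrank ℂ (f.eigenspace (η * ξ)) : ℂ) * (η * ξ) ^ 1 =
        (Module.finrank (ResidueField R) (g.eigenspace (red η)) * η : ℂ) * ξ := by
      intro ξ hξ
      rw [heq η hη ξ hξ]
      ring
    rw [Finset.sum_congr rfl h1, ← Finset.mul_sum, sum_nthRootsFinset_eq_zero _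
      (Nat.one_lt_pow ha hp.one_lt), mul_zero]
  rw [hf, Matrix.trace_toLin'_eq] at hfinal
  have : ((A.trace : ℤ) : ℂ) = 0 := by
    rw [← hfinal]
    simp [Matrix.trace]
  exact_mod_cast this

end TraceVanishing

/-! ### Two-sided translations on the group ring and the Berman–Higman theorem -/

section GroupRing

open Polynomial

variable {G : Type*} [Group G]

/-- The matrix, in the basis `G`, of the map `m ↦ g⁻¹ * m * u` on the group ring. -/
def translationMatrix (g : G) (u : MonoidAlgebra ℤ G) : Matrix G G ℤ :=
  Matrix.of fun y x => u.coeff (x⁻¹ * g * y)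

lemma translationMatrix_apply (g : G) (u : MonoidAlgebra ℤ G) (y x : G) :
    translationMatrix g u y x = u.coeff (x⁻¹ * g * y) := rfl

lemma coeff_mul_eq_sum [Fintype G] (a b : MonoidAlgebra ℤ G) (t : G) :
    (a * b).coeff t = ∑ s, a.coeff s * b.coeff (s⁻¹ * t) := by
  rw [MonoidAlgebra.coeff_mul_apply_left, Finsupp.sum_fintype]
  intro s
  exact zero_mul _

lemma augmentation_eq_sum [Fintype G] (u : MonoidAlgebra ℤ G) :
    augmentation G u = ∑ s, u.coeff s := by
  have h : augmentation G u = u.coeff.sum fun _ r => r := by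
    simp [augmentation, MonoidAlgebra.lift_apply]
  rw [h, Finsupp.sum_fintype _ _ fun _ => rfl]

lemma partialAugmentation_eq_sum [Fintype G] (x : G)
    (u : MonoidAlgebra ℤ G) [DecidablePred (IsConj x)] :
    partialAugmentation x u = ∑ g with IsConj x g, u.coeff g := by
  unfold partialAugmentation
  rw [Finset.sum_filter, Finset.sum_filter]
  rw [Finset.sum_subset (Finset.subset_univ _)]
  · exact Finset.sum_congr rfl fun g _ => by congr
  · intro g _ hg
    simp [Finsupp.notMem_support_iff.1 hg]

lemma translationMatrix_one [DecidableEq G] : translationMatrix (1 : G) 1 = 1 := by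
  ext y x
  rw [translationMatrix_apply, MonoidAlgebra.one_def, MonoidAlgebra.coeff_single,
    Finsupp.single_apply, Matrix.one_apply]
  congr 1
  rw [mul_one, eq_comm (a := 1), inv_mul_eq_one, eq_comm (a := x)]

variable [Fintype G]

lemma translationMatrix_mul (g g' : G) (u u' : MonoidAlgebra ℤ G) :
    translationMatrix g u * translationMatrix g' u' = translationMatrix (g' * g) (u' * u) := by
  ext y w
  rw [Matrix.mul_apply, translationMatrix_apply, coeff_mul_eq_sum]
  refine Fintype.sum_equiv (Equiv.mulLeft (w⁻¹ * g')) _ _ fun x => ?_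
  simp only [translationMatrix_apply, Equiv.coe_mulLeft]
  rw [mul_comm]
  congr 2
  group

variable [DecidableEq G]

lemma translationMatrix_pow (g : G) (u : MonoidAlgebra ℤ G) (n : ℕ) :
    translationMatrix g u ^ n = translationMatrix (g ^ n) (u ^ n) := by
  induction n with
  | zero => simp [translationMatrix_one]
  | succ n ih => rw [pow_succ, ih, translationMatrix_mul, ← pow_succ', ← pow_succ']

/-- The trace of `translationMatrix g u` is a positive multiple of `ε_g(u)`. -/
lemma exists_trace_translationMatrix_eq (g : G) (u : MonoidAlgebra ℤ G) :
    ∃ m : ℕ, 0 < m ∧ (translationMatrix g u).trace = m * partialAugmentation g u := by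
  classical
  -- The multiple is the order of the centraliser of `g`: every nonempty fibre of `y ↦ y⁻¹ * g * y`
  -- is a translate of it.
  refine ⟨(Finset.univ.filter fun y : G => y⁻¹ * g * y = g).card,
    Finset.card_pos.2 ⟨1, by simp⟩, ?_⟩
  rw [partialAugmentation_eq_sum, Finset.mul_sum]
  have h1 : (translationMatrix g u).trace = ∑ y : G, u.coeff (y⁻¹ * g * y) := rfl
  rw [h1, ← Finset.sum_fiberwise_of_maps_to (s := Finset.univ)
    (t := Finset.univ.filter (IsConj g)) (g := fun y : G => y⁻¹ * g * y)]
  · refine Finset.sum_congr rfl fun c hc => ?_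
    obtain ⟨z, hz⟩ := isConj_iff.1 (Finset.mem_filter.1 hc).2
    rw [Finset.sum_congr rfl (g := fun _ => u.coeff c)
      fun y hy => by rw [(Finset.mem_filter.1 hy).2], Finset.sum_const, nsmul_eq_mul]
    congr 2
    refine Finset.card_bij (fun y _ => y * z) ?_ ?_ ?_
    · intro y hy
      simp only [Finset.mem_filter, Finset.mem_univ, true_and] at hy ⊢
      rw [mul_inv_rev, show z⁻¹ * y⁻¹ * g * (y * z) = z⁻¹ * (y⁻¹ * g * y) * z by group, hy, ← hz]
      group
    · intro a _ b _ hab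
      exact mul_right_cancel hab
    · intro y hy
      simp only [Finset.mem_filter, Finset.mem_univ, true_and] at hy
      refine ⟨y * z⁻¹, ?_, by group⟩
      simp only [Finset.mem_filter, Finset.mem_univ, true_and]
      rw [mul_inv_rev, show z⁻¹⁻¹ * y⁻¹ * g * (y * z⁻¹) = z * (y⁻¹ * g * y) * z⁻¹ by group, hy, hz]
  · intro y _
    simp only [Finset.mem_filter, Finset.mem_univ, true_and]
    exact isConj_iff.2 ⟨y⁻¹, by group⟩

/-- The linear operator `m ↦ g⁻¹ * m * u` with coefficients in `k`. -/
noncomputable def translationEnd (k : Type*) [CommRing k] (g : G) (u : MonoidAlgebra ℤ G) :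
    Module.End k (G → k) :=
  Matrix.toLin' ((translationMatrix g u).map (Int.cast : ℤ → k))

lemma translationEnd_apply (k : Type*) [CommRing k] (g : G) (u : MonoidAlgebra ℤ G) (f : G → k)
    (y : G) : translationEnd k g u f y = ∑ x, (u.coeff (x⁻¹ * g * y) : k) * f x := by
  simp [translationEnd, Matrix.mulVec, dotProduct, translationMatrix_apply]

lemma translationEnd_pow (k : Type*) [CommRing k] (g : G) (u : MonoidAlgebra ℤ G) (n : ℕ) :
    translationEnd k g u ^ n = translationEnd k (g ^ n) (u ^ n) := by
  unfold translationEnd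
  rw [← Matrix.toLin'_pow, ← translationMatrix_pow]
  congr 1
  exact (map_pow (Int.castRingHom k).mapMatrix _ _).symm

lemma translationEnd_one (k : Type*) [CommRing k] : translationEnd k (1 : G) 1 = 1 := by
  have := translationEnd_pow k (1 : G) 1 0
  simpa using this.symm

lemma trace_translationEnd_one (u : MonoidAlgebra ℤ G) :
    LinearMap.trace ℂ (G → ℂ) (translationEnd ℂ 1 u) = Fintype.card G * u.coeff 1 := by
  rw [translationEnd, Matrix.trace_toLin'_eq]
  simp [Matrix.trace, translationMatrix_apply]

lemma translationEnd_one_injective {u : MonoidAlgebra ℤ G}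
    (h : translationEnd ℂ (1 : G) u = 1) : u = 1 := by
  rw [← translationEnd_one] at h
  ext y
  have := congrFun (LinearMap.congr_fun h (Pi.single 1 1)) y
  rw [translationEnd_apply, translationEnd_apply] at this
  simpa [Pi.single_apply] using this

/-- **Berman–Higman**: a torsion unit of augmentation one whose coefficient at `1` is nonzero is
trivial. -/
theorem eq_one_of_coeff_one_ne_zero (u : MonoidAlgebra ℤ G) (haug : augmentation G u = 1)
    (n : ℕ) (hn : 0 < n) (hu : u ^ n = 1) (h1 : u.coeff 1 ≠ 0) : u = 1 := by
  set f := translationEnd ℂ (1 : G) u with hf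
  have hfn : f ^ n = 1 := by rw [hf, translationEnd_pow, one_pow, hu, translationEnd_one]
  have ht := trace_pow_eq_sum f n hn hfn
  set b : ℂ → ℕ := fun ζ => Module.finrank ℂ (f.eigenspace ζ) with hb
  have ht0 : (Fintype.card G : ℝ) = ∑ ζ ∈ nthRootsFinset n (1 : ℂ), (b ζ : ℝ) := by
    have := ht 0
    rw [pow_zero, Module.End.one_eq_id, LinearMap.trace_id,
      Module.finrank_fintype_fun_eq_card] at this
    simp only [pow_zero, mul_one] at this
    exact_mod_cast this
  have ht1 : (Fintype.card G : ℝ) * u.coeff 1 =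
      ∑ ζ ∈ nthRootsFinset n (1 : ℂ), (b ζ : ℝ) * ζ.re := by
    have := ht 1
    rw [pow_one, hf, trace_translationEnd_one] at this
    have := congrArg Complex.re this
    simpa using this
  -- The integer `u.coeff 1` is the average of the real parts of the eigenvalues, all in [-1, 1]. If
  -- nonzero it sits at an endpoint or beyond, so all terms of this sum have one sign.
  have hsum : ∑ ζ ∈ nthRootsFinset n (1 : ℂ), (b ζ : ℝ) * (ζ.re - u.coeff 1) = 0 := by
    simp only [mul_sub]
    rw [Finset.sum_sub_distrib, ← Finset.sum_mul, ← ht0, ← ht1, sub_self]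
  have hnorm : ∀ ζ ∈ nthRootsFinset n (1 : ℂ), ‖ζ‖ = 1 := fun ζ hζ =>
    Complex.norm_eq_one_of_pow_eq_one ((mem_nthRootsFinset hn _).1 hζ) hn.ne'
  have hre : ∀ ζ ∈ nthRootsFinset n (1 : ℂ), |ζ.re| ≤ 1 := fun ζ hζ =>
    (Complex.abs_re_le_norm ζ).trans (hnorm ζ hζ).le
  have h1mem : (1 : ℂ) ∈ nthRootsFinset n (1 : ℂ) := by rw [mem_nthRootsFinset hn, one_pow]
  -- Augmentation one makes the constant functions fixed vectors; this excludes a negative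
  -- coefficient at 1.
  have hb1 : 0 < b 1 := by
    rw [hb, Module.finrank_pos_iff_exists_ne_zero]
    refine ⟨⟨fun _ => 1, ?_⟩, ?_⟩
    · rw [Module.End.mem_eigenspace_iff, one_smul]
      ext y
      rw [hf, translationEnd_apply]
      simp only [mul_one]
      rw [augmentation_eq_sum] at haug
      rw [← Int.cast_sum, ← Int.cast_one, ← haug]
      congr 1
      exact Fintype.sum_equiv ((Equiv.inv G).trans (Equiv.mulRight y)) _ _ fun x => rfl
    · intro h
      have := congrFun (congrArg Subtype.val h) 1
      exact one_ne_zero this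
  rcases lt_or_gt_of_ne h1 with hneg | hpos
  · exfalso
    have hneg' : (u.coeff 1 : ℝ) ≤ -1 := by exact_mod_cast (by omega : u.coeff 1 ≤ -1)
    have hnn : ∀ ζ ∈ nthRootsFinset n (1 : ℂ), 0 ≤ (b ζ : ℝ) * (ζ.re - u.coeff 1) := by
      intro ζ hζ
      have := (abs_le.1 (hre ζ hζ)).1
      exact mul_nonneg (Nat.cast_nonneg _) (by linarith)
    have h := (Finset.sum_eq_zero_iff_of_nonneg hnn).1 hsum 1 h1mem
    have hb1' : (0 : ℝ) < b 1 := by exact_mod_cast hb1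
    rw [Complex.one_re] at h
    have : 0 < (b 1 : ℝ) * (1 - u.coeff 1) := mul_pos hb1' (by linarith)
    linarith
  · have hpos' : (1 : ℝ) ≤ u.coeff 1 := by exact_mod_cast (by omega : 1 ≤ u.coeff 1)
    have hnn : ∀ ζ ∈ nthRootsFinset n (1 : ℂ), (b ζ : ℝ) * (ζ.re - u.coeff 1) ≤ 0 := by
      intro ζ hζ
      have := (abs_le.1 (hre ζ hζ)).2
      exact mul_nonpos_of_nonneg_of_nonpos (Nat.cast_nonneg _) (by linarith)
    have h := (Finset.sum_eq_zero_iff_of_nonpos hnn).1 hsum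
    have hbz : ∀ ζ ∈ nthRootsFinset n (1 : ℂ), ζ ≠ 1 → b ζ = 0 := by
      intro ζ hζ hne
      rcases mul_eq_zero.1 (h ζ hζ) with h0 | h0
      · exact_mod_cast h0
      · exfalso
        apply hne
        have hre1 : ζ.re = 1 := le_antisymm (abs_le.1 (hre ζ hζ)).2 (by linarith)
        have him := Complex.sq_norm_sub_sq_re ζ
        rw [hnorm ζ hζ, hre1] at him
        apply Complex.ext
        · rw [hre1, Complex.one_re]
        · rw [Complex.one_im]
          nlinarith
    have hcard : Module.finrank ℂ (f.eigenspace 1) = Module.finrank ℂ (G → ℂ) := by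
      rw [Module.finrank_fintype_fun_eq_card]
      rw [Finset.sum_eq_single_of_mem 1 h1mem
        fun ζ hζ hne => by rw [hbz ζ hζ hne, Nat.cast_zero]] at ht0
      exact_mod_cast ht0.symm
    have htop := Submodule.eq_top_of_finrank_eq hcard
    apply translationEnd_one_injective
    refine LinearMap.ext fun v => ?_
    have hv : v ∈ f.eigenspace 1 := htop ▸ Submodule.mem_top
    rw [Module.End.mem_eigenspace_iff, one_smul] at hv
    exact hv

/-- A unit of prime order and augmentation one acts with fixed space of dimension `|G| / p`. -/
theorem mul_finrank_ker_translationEnd_sub_one (p : ℕ) (hp : p.Prime) (v : MonoidAlgebra ℤ G)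
    (haug : augmentation G v = 1) (hv : v ^ p = 1) (hv1 : v ≠ 1) :
    p * Module.finrank ℂ (LinearMap.ker (translationEnd ℂ 1 v - 1)) = Fintype.card G := by
  set f := translationEnd ℂ (1 : G) v with hf
  have hfn : f ^ p = 1 := by rw [hf, translationEnd_pow, one_pow, hv, translationEnd_one]
  have ht := trace_pow_eq_sum f p hp.pos hfn
  have h1mem : (1 : ℂ) ∈ nthRootsFinset p (1 : ℂ) := by rw [mem_nthRootsFinset hp.pos, one_pow]
  -- By Berman–Higman the nontrivial powers of `v` have coefficient 0 at 1, so only `j = 0` has a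
  -- nonzero trace.
  have hL : ∑ j ∈ Finset.range p, LinearMap.trace ℂ (G → ℂ) (f ^ j) = Fintype.card G := by
    rw [Finset.sum_eq_single_of_mem 0 (Finset.mem_range.2 hp.pos)]
    · rw [pow_zero, Module.End.one_eq_id, LinearMap.trace_id,
        Module.finrank_fintype_fun_eq_card]
    · intro j hj hj0
      rw [hf, translationEnd_pow, one_pow, trace_translationEnd_one]
      have : (v ^ j).coeff 1 = 0 := by
        by_contra hne
        have h1 := eq_one_of_coeff_one_ne_zero (v ^ j) (by rw [map_pow, haug, one_pow]) p hp.pos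
          (by rw [← pow_mul, mul_comm, pow_mul, hv, one_pow]) hne
        have hc : j.Coprime p := (Nat.coprime_of_lt_prime hj0 (Finset.mem_range.1 hj) hp).symm
        exact hv1 (by simpa [hc.gcd_eq_one] using pow_gcd_eq_one.2 ⟨h1, hv⟩)
      rw [this, Int.cast_zero, mul_zero]
  have hR : ∑ j ∈ Finset.range p, LinearMap.trace ℂ (G → ℂ) (f ^ j) =
      p * Module.finrank ℂ (f.eigenspace 1) := by
    rw [Finset.sum_congr rfl fun j _ => ht j, Finset.sum_comm,
      Finset.sum_eq_single_of_mem 1 h1mem]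
    · simp
    · intro ζ hζ hne
      rw [mem_nthRootsFinset hp.pos] at hζ
      rw [← Finset.mul_sum]
      have h1 : (∑ j ∈ Finset.range p, ζ ^ j) * (ζ - 1) = 0 := by
        rw [geom_sum_mul, hζ, sub_self]
      rw [(mul_eq_zero.1 h1).resolve_right (sub_ne_zero.2 hne), mul_zero]
  rw [hL] at hR
  have h1 : f.eigenspace 1 = LinearMap.ker (f - 1) := by
    rw [Module.End.eigenspace_def, one_smul]
  rw [← h1]
  exact_mod_cast hR.symm

end GroupRing

/-! ### Higman's criterion and a weak form of Weiss' theorem -/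

section Lifting

/-- Cohomological triviality from Higman's criterion. -/
lemma exists_eq_norm_of_higman {M : Type*} [AddCommGroup M] (p : ℕ) (n θ : Module.End ℤ M)
    (hθ : ∑ j ∈ Finset.range p, n ^ j * θ * n ^ (p - j) = 1) (m : M) (hm : n m = m) : ∃ m', m = (∑ j ∈ Finset.range p, n ^ j) m' := by
  have hfix : ∀ i : ℕ, (n ^ i) m = m := by
    intro i
    induction i with
    | zero => simp
    | succ i ih => rw [pow_succ, Module.End.mul_apply, hm, ih]
  refine ⟨θ m, ?_⟩
  have h := LinearMap.congr_fun hθ m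
  rw [Module.End.one_apply, LinearMap.sum_apply] at h
  rw [LinearMap.sum_apply, ← Finset.sum_congr rfl fun j _ => ?_]
  · exact h.symm
  · rw [Module.End.mul_apply, Module.End.mul_apply, hfix]

/-- Since n^(p-j) = n^(-j), the sum of the θ n^(-j) m is θ applied to the norm of m, hence zero.
Subtracting it from m = Σ n^j θ n^(-j) m leaves terms with a factor n^j - 1, each divisible by n -
1. -/
lemma exists_eq_sub_one_of_higman {M : Type*} [AddCommGroup M] (p : ℕ) (n θ : Module.End ℤ M)
    (hn : n ^ p = 1) (hθ : ∑ j ∈ Finset.range p, n ^ j * θ * n ^ (p - j) = 1) (m : M)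
    (hm : (∑ j ∈ Finset.range p, n ^ j) m = 0) : ∃ m', m = (n - 1) m' := by
  have hrefl : ∑ j ∈ Finset.range p, n ^ (p - j) = ∑ j ∈ Finset.range p, n ^ j := by
    cases p with
    | zero => simp
    | succ k =>
      rw [Finset.sum_range_succ', Finset.sum_range_succ', Nat.sub_zero, hn, pow_zero]
      congr 1
      rw [← Finset.sum_range_reflect]
      refine Finset.sum_congr rfl fun j hj => ?_
      have := Finset.mem_range.1 hj
      congr 1
      omega
  have h0 : ∑ j ∈ Finset.range p, θ ((n ^ (p - j)) m) = 0 := by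
    rw [← map_sum, ← LinearMap.sum_apply, hrefl, hm, map_zero]
  refine ⟨∑ j ∈ Finset.range p, (∑ i ∈ Finset.range j, n ^ i) (θ ((n ^ (p - j)) m)), ?_⟩
  have h := LinearMap.congr_fun hθ m
  rw [Module.End.one_apply, LinearMap.sum_apply] at h
  rw [map_sum]
  conv_lhs => rw [← h, ← sub_zero (∑ j ∈ Finset.range p, _), ← h0, ← Finset.sum_sub_distrib]
  refine Finset.sum_congr rfl fun j _ => ?_
  have := LinearMap.congr_fun (mul_geom_sum n j) (θ ((n ^ (p - j)) m))
  simpa only [Module.End.mul_apply, LinearMap.sub_apply, Module.End.one_apply] using this.symm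

/-- The vanishing of `H¹(⟨c⟩, M)` from that of `H¹(⟨c⟩, M ^ n)`, for commuting endomorphisms. -/
theorem exists_eq_sub_of_invariants {M : Type*} [AddCommGroup M] (p : ℕ) (hp : p.Prime)
    (n c θ : Module.End ℤ M) (hnc : Commute n c) (hn : n ^ p = 1) (hc : c ^ p = 1)
    (hθ : ∑ j ∈ Finset.range p, n ^ j * θ * n ^ (p - j) = 1)
    (htf : ∀ m : M, (p : ℤ) • m = 0 → m = 0)
    (hX : ∀ x : M, n x = x → (∑ j ∈ Finset.range p, c ^ j) x = 0 →
      ∃ x', n x' = x' ∧ x = c x' - x')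
    (m : M) (hm : (∑ j ∈ Finset.range p, c ^ j) m = 0) : ∃ m', m = c m' - m' := by
  -- The module-theoretic statement needs a commutative ring of operators; the subalgebra generated
  -- by `n` and `c` serves.
  have := Algebra.isMulCommutative_adjoin ℤ (s := {n, c}) (by
      rintro a (rfl | rfl) b (rfl | rfl)
      · rfl
      · exact hnc
      · exact hnc.symm
      · rfl)
  let : CommRing (Algebra.adjoin ℤ ({n, c} : Set (Module.End ℤ M))) :=
    { (inferInstance : Ring (Algebra.adjoin ℤ ({n, c} : Set (Module.End ℤ M)))) with
      mul_comm := this.is_comm.comm }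
  let n' : Algebra.adjoin ℤ ({n, c} : Set (Module.End ℤ M)) :=
    ⟨n, Algebra.subset_adjoin (by simp)⟩
  let c' : Algebra.adjoin ℤ ({n, c} : Set (Module.End ℤ M)) :=
    ⟨c, Algebra.subset_adjoin (by simp)⟩
  have hsum : ∀ (a : Algebra.adjoin ℤ ({n, c} : Set (Module.End ℤ M))) (x : M),
      (∑ j ∈ Finset.range p, a ^ j) • x = (∑ j ∈ Finset.range p, (a : Module.End ℤ M) ^ j) x := by
    intro a x
    have : ((∑ j ∈ Finset.range p, a ^ j : Algebra.adjoin ℤ ({n, c} : Set (Module.End ℤ M))) :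
      Module.End ℤ M) = ∑ j ∈ Finset.range p, (a : Module.End ℤ M) ^ j := by
      push_cast
      rfl
    rw [← this]
    rfl
  have hsub : ∀ (a : Algebra.adjoin ℤ ({n, c} : Set (Module.End ℤ M))) (x : M),
      (a - 1) • x = (a : Module.End ℤ M) x - x := fun a x => by
    rw [sub_smul, one_smul]
    rfl
  obtain ⟨m', hm'⟩ := exists_smul_eq_of_invariants p hp n' c' (Subtype.ext hn) (Subtype.ext hc)
    (M := M) (fun m h => htf m (by
      rw [← h, natCast_zsmul]
      exact (Nat.cast_smul_eq_nsmul (Algebra.adjoin ℤ ({n, c} : Set (Module.End ℤ M))) p m).symm))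
    (fun m hm => by
      obtain ⟨x, hx⟩ := exists_eq_norm_of_higman p n θ hθ m hm
      exact ⟨x, by rw [hsum]; exact hx⟩)
    (fun m hm => by
      rw [hsum] at hm
      obtain ⟨x, hx⟩ := exists_eq_sub_one_of_higman p n θ hn hθ m hm
      exact ⟨x, by rw [hsub]; exact hx⟩)
    (fun x hx hx' => by
      rw [hsum] at hx'
      obtain ⟨y, hy, hy'⟩ := hX x hx hx'
      exact ⟨y, hy, by rw [hsub]; exact hy'⟩) m (by rw [hsum]; exact hm)
  exact ⟨m', by rw [hsub] at hm'; exact hm'⟩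

variable {G : Type*} [Group G]

/-- If `n ∉ H` has prime order `p` and commutes with `H`, there is a left `H`-invariant function on
`G` whose values sum to one along each `⟨n⟩`-orbit. -/
lemma exists_invariant_sum_eq_one (p : ℕ) (hp : p.Prime) (H : Subgroup G) (n : G)
    (hnp : n ^ p = 1) (hnH : n ∉ H) (hcomm : ∀ h ∈ H, Commute n h) :
    ∃ δ : G → ℕ, (∀ h ∈ H, ∀ g, δ (h * g) = δ g) ∧
      ∀ g, ∑ j ∈ Finset.range p, δ (n ^ j * g) = 1 := by
  classical
  -- This is `H⟨n⟩`; keeping `Commute n k` in the definition makes the closure properties direct.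
  let K : Subgroup G :=
    { carrier := {k | Commute n k ∧ ∃ i : ℕ, n ^ i * k ∈ H}
      one_mem' := ⟨Commute.one_right n, 0, by simp [H.one_mem]⟩
      mul_mem' := by
        rintro a b ⟨ha, i, hi⟩ ⟨hb, j, hj⟩
        refine ⟨ha.mul_right hb, i + j, ?_⟩
        have : n ^ (i + j) * (a * b) = (n ^ i * a) * (n ^ j * b) := by
          rw [pow_add, mul_assoc, ← mul_assoc (n ^ j) a b, (ha.pow_left j).eq]
          group
        rw [this]
        exact H.mul_mem hi hj
      inv_mem' := by
        rintro a ⟨ha, i, hi⟩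
        refine ⟨ha.inv_right, i * (p - 1), ?_⟩
        have h1 : n ^ (i * (p - 1)) = (n ^ i)⁻¹ := by
          rw [eq_inv_iff_mul_eq_one, ← pow_add]
          have : i * (p - 1) + i = p * i := by
            obtain ⟨q, rfl⟩ : ∃ q, p = q + 1 := ⟨p - 1, by have := hp.pos; omega⟩
            simp only [Nat.add_sub_cancel]
            ring
          rw [this, pow_mul, hnp, one_pow]
        have h2 := H.inv_mem hi
        rw [mul_inv_rev] at h2
        rw [h1]
        rwa [((ha.pow_left i).inv_inv).eq] }
  have hHK : H ≤ K := fun h hh => ⟨hcomm h hh, 0, by simpa using hh⟩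
  have hnK : n ∈ K := ⟨Commute.refl n, p - 1, by
    rw [← pow_succ, Nat.sub_add_cancel hp.one_le, hnp]; exact H.one_mem⟩
  let r : G → G := fun g => Quotient.out (s := QuotientGroup.rightRel K) (Quotient.mk _ g)
  have hr : ∀ k ∈ K, ∀ g, r (k * g) = r g := by
    intro k hk g
    have : (Quotient.mk (QuotientGroup.rightRel K) (k * g)) =
        Quotient.mk (QuotientGroup.rightRel K) g := by
      apply Quotient.sound
      change QuotientGroup.rightRel K (k * g) g
      rw [QuotientGroup.rightRel_apply, mul_inv_rev, ← mul_assoc, mul_inv_cancel, one_mul]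
      exact K.inv_mem hk
    simp only [r, this]
  have hgr : ∀ g, g * (r g)⁻¹ ∈ K := by
    intro g
    have : QuotientGroup.rightRel K (r g) g := Quotient.exact (Quotient.out_eq _)
    rwa [QuotientGroup.rightRel_apply] at this
  -- The indicator of `H` times a set of representatives for the cosets `K g`. Along an `⟨n⟩`-orbit
  -- it is 1 exactly once, because `⟨n⟩` meets `H` trivially.
  refine ⟨fun g => if g * (r g)⁻¹ ∈ H then 1 else 0, ?_, ?_⟩
  · intro h hh g
    simp only [hr h (hHK hh), mul_assoc]
    rw [H.mul_mem_cancel_left hh]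
  · intro g
    simp only [hr _ (K.pow_mem hnK _), mul_assoc]
    obtain ⟨hcκ, i, hi⟩ := hgr g
    set κ := g * (r g)⁻¹
    have hmod : n ^ (i % p) = n ^ i := by
      conv_rhs => rw [← Nat.div_add_mod i p, pow_add, pow_mul, hnp, one_pow, one_mul]
    rw [Finset.sum_eq_single_of_mem (i % p) (Finset.mem_range.2 (Nat.mod_lt _ hp.pos))]
    · rw [hmod, if_pos hi]
    · intro j hj hne
      rw [if_neg]
      intro hjH
      apply hne
      by_contra hne'
      -- the quotient of the two elements is a nontrivial power of `n` in `H`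
      have h1 : (n ^ (i % p)) * (n ^ j)⁻¹ ∈ H := by
        rw [← hmod] at hi
        have := H.mul_mem hi (H.inv_mem hjH)
        rwa [mul_inv_rev, ← mul_assoc, mul_assoc (n ^ (i % p)), mul_inv_cancel, mul_one] at this
      have hcast : n ^ ((i % p : ℕ) - j : ℤ) ∈ H := by
        rw [zpow_sub, zpow_natCast, zpow_natCast]; exact h1
      have hj' := Finset.mem_range.1 hj
      have hi' := Nat.mod_lt i hp.pos
      set d : ℤ := (i % p : ℕ) - j
      have hd : IsCoprime d p := by
        rw [Int.isCoprime_iff_gcd_eq_one, Int.gcd_comm]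
        have := (Nat.Prime.coprime_iff_not_dvd (n := d.natAbs) hp).2 (by
          intro hdvd
          have hd' : d = (i % p : ℕ) - j := rfl
          have := Nat.le_of_dvd (by omega) hdvd
          omega)
        simpa [Int.gcd] using this
      obtain ⟨a, b, hab⟩ := hd
      apply hnH
      have : n = (n ^ d) ^ a := by
        rw [← zpow_mul]
        conv_lhs => rw [← zpow_one n, ← hab, zpow_add, mul_comm b, zpow_mul n p b, zpow_natCast, hnp,
          one_zpow, mul_one, mul_comm]
      rw [this]
      exact H.zpow_mem hcast a

/-- The subgroup of left translations fixing a function. -/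
def leftStabilizer {R : Type*} (f : G → R) : Subgroup G where
  carrier := {g | ∀ y, f (g * y) = f y}
  one_mem' y := by rw [one_mul]
  mul_mem' := fun {a b} ha hb y => by rw [mul_assoc, ha, hb]
  inv_mem' := fun {a} ha y => by rw [← ha (a⁻¹ * y), mul_inv_cancel_left]

/-- The functions on `G` invariant under left translation by `H`. -/
def leftInvariants (R : Type*) [CommRing R] (H : Subgroup G) : Submodule R (G → R) where
  carrier := {f | H ≤ leftStabilizer f}
  zero_mem' := fun _ _ _ => rfl
  add_mem' := fun {a b} ha hb g hg y => by
    rw [Pi.add_apply, Pi.add_apply, ha hg, hb hg]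
  smul_mem' := fun r a ha g hg y => by
    rw [Pi.smul_apply, Pi.smul_apply, ha hg]

/-- Left translation by `g` on functions. -/
def leftTranslation (R : Type*) [CommRing R] (g : G) : Module.End R (G → R) where
  toFun f y := f (g * y)
  map_add' _ _ := rfl
  map_smul' _ _ := rfl

lemma leftTranslation_pow (R : Type*) [CommRing R] (g : G) (j : ℕ) (f : G → R) (y : G) :
    (leftTranslation R g ^ j) f y = f (g ^ j * y) := by
  induction j generalizing y with
  | zero => simp
  | succ j ih =>
    rw [pow_succ', Module.End.mul_apply]
    change ((leftTranslation R g ^ j) f) (g * y) = _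
    rw [ih, pow_succ, mul_assoc]

/-- A weak form of Weiss' theorem: if `c` has order dividing `p`, commutes with the left
translations by the elementary abelian group `N`, and fixes the `N`-invariant functions, then
`H¹(⟨c⟩, R ^ G) = 0`. -/
theorem exists_eq_sub_of_fixes_leftInvariants [Finite G] (p : ℕ) (hp : p.Prime)
    (R : Type*) [CommRing R] [IsDomain R] [CharZero R] (N : Subgroup G)
    (hcomm : ∀ a ∈ N, ∀ b ∈ N, a * b = b * a) (hexp : ∀ a ∈ N, a ^ p = 1)
    (c : Module.End R (G → R)) (hc : c ^ p = 1)
    (hcN : ∀ a ∈ N, Commute (leftTranslation R a) c)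
    (hfix : ∀ f ∈ leftInvariants R N, c f = f) (f : G → R)
    (hf : (∑ j ∈ Finset.range p, c ^ j) f = 0) : ∃ f', f = c f' - f' := by
  have hcinv : ∀ H ≤ N, ∀ f ∈ leftInvariants R H, c f ∈ leftInvariants R H := by
    intro H hH f hf h hh y
    have h1 := LinearMap.congr_fun (hcN h (hH hh)).eq f
    have h2 : leftTranslation R h f = f := funext fun y => hf hh y
    rw [Module.End.mul_apply, Module.End.mul_apply, h2] at h1
    exact congrFun h1 y
  have key : ∀ H : Subgroup G, H ≤ N → ∀ f ∈ leftInvariants R H,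
      (∑ j ∈ Finset.range p, c ^ j) f = 0 → ∃ f' ∈ leftInvariants R H, f = c f' - f' := by
    intro H
    -- The induction descends from `N` to the trivial subgroup: the hypothesis is available for all
    -- larger subgroups.
    induction H using WellFoundedGT.induction with
    | ind H ih =>
    intro hHN f hf hf0
    rcases eq_or_lt_of_le hHN with rfl | hlt
    · have hpow : ∀ j : ℕ, (c ^ j) f = f := by
        intro j
        induction j with
        | zero => simp
        | succ j ihj => rw [pow_succ, Module.End.mul_apply, hfix f hf, ihj]
      have h0 : f = 0 := by
        rw [LinearMap.sum_apply, Finset.sum_congr rfl fun j _ => hpow j, Finset.sum_const,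
          Finset.card_range] at hf0
        ext y
        have := congrFun hf0 y
        simpa [hp.ne_zero] using this
      exact ⟨0, zero_mem _, by rw [h0]; simp⟩
    obtain ⟨n, hnN, hnH⟩ := SetLike.exists_of_lt hlt
    have hH' : H ⊔ Subgroup.zpowers n ≤ N := sup_le hHN (by simpa using hnN)
    have hlt' : H < H ⊔ Subgroup.zpowers n := lt_of_le_of_ne le_sup_left fun h =>
      hnH (h ▸ (le_sup_right : _ ≤ H ⊔ Subgroup.zpowers n) (Subgroup.mem_zpowers n))
    have ih' := ih _ hlt' hH'
    obtain ⟨δ, hδH, hδ⟩ := exists_invariant_sum_eq_one p hp H n (hexp n hnN) hnH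
      fun h hh => hcomm n hnN h (hHN hh)
    have hσinv : ∀ f ∈ leftInvariants R H, leftTranslation R n f ∈ leftInvariants R H := by
      intro f hf h hh y
      change f (n * (h * y)) = f (n * y)
      rw [← mul_assoc, hcomm n hnN h (hHN hh), mul_assoc]
      exact hf hh _
    have hδinv : ∀ f ∈ leftInvariants R H, (fun y => (δ y : R) * f y) ∈ leftInvariants R H := by
      intro f hf h hh y
      change (δ (h * y) : R) * f (h * y) = δ y * f y
      rw [hδH h hh, hf hh]
    let M := leftInvariants R H
    let n' : Module.End ℤ M := ((leftTranslation R n).restrict hσinv).restrictScalars ℤ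
    let c' : Module.End ℤ M := (c.restrict (hcinv H hHN)).restrictScalars ℤ
    -- Multiplication by `δ` is the operator for Higman's criterion: its translates under `n` sum to
    -- the identity.
    let θ : Module.End ℤ M :=
      { toFun := fun f => ⟨fun y => (δ y : R) * (f : G → R) y, hδinv f f.2⟩
        map_add' := fun a b => by ext y; exact mul_add _ _ _
        map_smul' := fun a b => by
          ext y
          change (δ y : R) * (a • (b : G → R) y) = a • ((δ y : R) * (b : G → R) y)
          rw [mul_smul_comm] }
    have hn' : ∀ (j : ℕ) (x : M) (y : G), ((n' ^ j) x : G → R) y = (x : G → R) (n ^ j * y) := by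
      intro j
      induction j with
      | zero => intro x y; simp
      | succ j ihj =>
        intro x y
        rw [pow_succ', Module.End.mul_apply]
        change ((n' ^ j) x : G → R) (n * y) = _
        rw [ihj, pow_succ, mul_assoc]
    have hc' : ∀ (j : ℕ) (x : M), ((c' ^ j) x : G → R) = (c ^ j) (x : G → R) := by
      intro j
      induction j with
      | zero => intro x; simp
      | succ j ihj =>
        intro x
        rw [pow_succ', Module.End.mul_apply, pow_succ', Module.End.mul_apply, ← ihj]
        rfl
    have hc'sum : ∀ x : M, (((∑ j ∈ Finset.range p, c' ^ j) x : M) : G → R) =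
        (∑ j ∈ Finset.range p, c ^ j) (x : G → R) := by
      intro x
      rw [LinearMap.sum_apply, LinearMap.sum_apply, AddSubmonoidClass.coe_finsetSum]
      exact Finset.sum_congr rfl fun j _ => hc' j x
    have hmem : ∀ x : M, n' x = x → (x : G → R) ∈ leftInvariants R (H ⊔ Subgroup.zpowers n) := by
      intro x hx
      refine sup_le (show H ≤ leftStabilizer (x : G → R) from x.2) ?_
      rw [Subgroup.zpowers_le]
      intro y
      exact congrFun (congrArg Subtype.val hx) y
    obtain ⟨f', hf'⟩ := exists_eq_sub_of_invariants p hp n' c' θ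
      (by
        refine LinearMap.ext fun x => Subtype.ext ?_
        exact LinearMap.congr_fun (hcN n hnN).eq (x : G → R))
      (by
        refine LinearMap.ext fun x => Subtype.ext (funext fun y => ?_)
        rw [hn', hexp n hnN, one_mul, Module.End.one_apply])
      (by
        refine LinearMap.ext fun x => Subtype.ext ?_
        rw [hc', hc, Module.End.one_apply, Module.End.one_apply])
      (by
        refine LinearMap.ext fun x => Subtype.ext (funext fun y => ?_)
        rw [LinearMap.sum_apply, AddSubmonoidClass.coe_finsetSum, Finset.sum_apply,
          Module.End.one_apply]
        rw [Finset.sum_congr rfl (g := fun j => (δ (n ^ j * y) : R) * (x : G → R) y)]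
        · rw [← Finset.sum_mul, ← Nat.cast_sum, hδ, Nat.cast_one, one_mul]
        · intro j hj
          rw [Module.End.mul_apply, Module.End.mul_apply, hn']
          change (δ (n ^ j * y) : R) * ((n' ^ (p - j)) x : G → R) (n ^ j * y) = _
          rw [hn', ← mul_assoc, ← pow_add, Nat.sub_add_cancel (Finset.mem_range.1 hj).le,
            hexp n hnN, one_mul])
      (by
        intro m hm
        ext y
        have := congrFun (congrArg Subtype.val hm) y
        have h2 : (p : R) * (m : G → R) y = 0 := by simpa using this
        exact (mul_eq_zero.1 h2).resolve_left (Nat.cast_ne_zero.2 hp.ne_zero))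
      (by
        intro x hx hx0
        obtain ⟨w, hw, hw'⟩ := ih' x (hmem x hx) (by
          rw [← hc'sum, hx0]; rfl)
        exact ⟨⟨w, fun h hh => hw ((le_sup_left : H ≤ H ⊔ Subgroup.zpowers n) hh)⟩, Subtype.ext (funext fun y =>
          hw (le_sup_right (a := H) (Subgroup.mem_zpowers n)) y), Subtype.ext hw'⟩)
      ⟨f, hf⟩ (Subtype.ext (by rw [hc'sum]; exact hf0))
    exact ⟨f', f'.2, congrArg Subtype.val hf'⟩
  obtain ⟨f', -, hf'⟩ := key ⊥ bot_le f (by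
    intro g hg y
    rw [Subgroup.mem_bot.1 hg, one_mul]) hf
  exact ⟨f', hf'⟩

end Lifting

/-! ### Vanishing of partial augmentations -/

section Vanishing

open IsLocalRing

variable {G : Type*} [Group G]

/-- The identity is proved for the polynomial variable and then evaluated at `σ`, so `A` need not be
commutative. -/
lemma geom_sum_eq_sub_one_pow_of_charP {k A : Type*} [Field k] [Ring A] [Algebra k A] (p : ℕ)
    (hp : p.Prime) [CharP k p] (σ : A) :
    ∑ j ∈ Finset.range p, σ ^ j = (σ - 1) ^ (p - 1) := by
  obtain ⟨b, hb⟩ := geom_sum_prime_eq p hp (Polynomial.X : Polynomial k)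
  rw [CharP.cast_eq_zero, zero_mul, add_zero] at hb
  have := congrArg (Polynomial.aeval σ) hb
  simpa using this

/-- A coordinate of largest valuation divides all the others. This replaces division by a
uniformiser, as the valuation need not be discrete. -/
lemma exists_eq_mul_of_valuationSubring {ι : Type*} [Finite ι] [Nonempty ι] (R : ValuationSubring ℂ)
    (w : ι → R) : ∃ (i₀ : ι) (y : ι → R), ∀ i, w i = w i₀ * y i := by
  have := Fintype.ofFinite ι
  obtain ⟨i₀, -, hi₀⟩ := Finset.exists_max_image Finset.univ
    (fun i => R.valuation (w i)) Finset.univ_nonempty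
  refine ⟨i₀, fun i => ⟨(w i : ℂ) / w i₀, ?_⟩, fun i => Subtype.ext ?_⟩
  · rw [← R.valuation_le_one_iff, map_div₀]
    exact div_le_one_of_le₀ (hi₀ i (Finset.mem_univ _)) zero_le
  · by_cases h0 : (w i₀ : ℂ) = 0
    · have := hi₀ i (Finset.mem_univ _)
      rw [h0, map_zero, le_zero_iff, map_eq_zero] at this
      push_cast
      rw [this, h0, zero_mul]
    · push_cast
      rw [mul_div_cancel₀ _ h0]

/-- The orbits of `w` on `G` are regular. Cutting a fixed function down to one point per orbit and
taking the norm, which is `(w - 1) ^ (p - 1)` here, recovers it. -/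
lemma ker_leftTranslation_sub_one_le {k : Type*} [Field k] (p : ℕ) (hp : p.Prime) [CharP k p]
    (w : G) (hw : w ^ p = 1) (hw1 : w ≠ 1) :
    LinearMap.ker (leftTranslation k w - 1) ≤
      LinearMap.range ((leftTranslation k w - 1) ^ (p - 1)) := by
  intro f hf
  rw [LinearMap.mem_ker, LinearMap.sub_apply, sub_eq_zero, Module.End.one_apply] at hf
  have hfix : ∀ (j : ℕ) (y : G), f (w ^ j * y) = f y := by
    intro j
    induction j with
    | zero => simp
    | succ j ih =>
      intro y
      rw [pow_succ, mul_assoc, ih]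
      exact congrFun hf y
  obtain ⟨δ, -, hδ⟩ := exists_invariant_sum_eq_one p hp (⊥ : Subgroup G) w hw
    (by rwa [Subgroup.mem_bot]) fun h hh => by
      rw [Subgroup.mem_bot.1 hh]
      exact Commute.one_right w
  refine ⟨fun y => (δ y : k) * f y, ?_⟩
  rw [← geom_sum_eq_sub_one_pow_of_charP (k := k) p hp, LinearMap.sum_apply]
  ext y
  rw [Finset.sum_apply]
  simp only [leftTranslation_pow, hfix]
  rw [← Finset.sum_mul, ← Nat.cast_sum, hδ, Nat.cast_one, one_mul]

variable [Fintype G]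

lemma partialAugmentation_eq_zero_of_ker_le_range (p : ℕ) (hp : p.Prime) (R : ValuationSubring ℂ)
    [CharP (ResidueField R) p] [DecidableEq G] (x : G) (u : MonoidAlgebra ℤ G) (n : ℕ) (hn : 0 < n)
    (hpn : p ∣ n) (hx : x ^ n = 1) (hu : u ^ n = 1)
    (hz : LinearMap.ker (translationEnd (ResidueField R) (x ^ (n / p)) (u ^ (n / p)) - 1) ≤
      LinearMap.range
        ((translationEnd (ResidueField R) (x ^ (n / p)) (u ^ (n / p)) - 1) ^ (p - 1))) :
    partialAugmentation x u = 0 := by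
  have h := trace_eq_zero_of_ker_le_range p hp R (translationMatrix x u) n hn hpn
    (by rw [translationMatrix_pow, hx, hu, translationMatrix_one])
    (by rw [← translationEnd_pow] at hz; exact hz)
  obtain ⟨m, hm, hm'⟩ := exists_trace_translationMatrix_eq x u
  rw [h] at hm'
  have hm0 : (m : ℤ) ≠ 0 := by exact_mod_cast hm.ne'
  exact (mul_eq_zero.1 hm'.symm).resolve_left hm0

lemma translationEnd_group_one [DecidableEq G] (k : Type*) [CommRing k] (w : G) :
    translationEnd k w 1 = leftTranslation k w := by
  refine LinearMap.ext fun f => funext fun y => ?_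
  rw [translationEnd_apply, Finset.sum_eq_single (w * y)]
  · change _ = f (w * y)
    rw [show (w * y)⁻¹ * w * y = 1 by group, MonoidAlgebra.coeff_one_one, Int.cast_one, one_mul]
  · intro x _ hx
    rw [MonoidAlgebra.one_def, MonoidAlgebra.coeff_single, Finsupp.single_apply, if_neg,
      Int.cast_zero, zero_mul]
    intro h
    apply hx
    rw [mul_assoc, eq_comm, inv_mul_eq_one] at h
    exact h
  · simp

/-- If `ε_x(u) ≠ 0` for a torsion unit `u`, then the order of `x` divides that of `u`. -/
theorem pow_eq_one_of_partialAugmentation_ne_zero (x : G) (u : MonoidAlgebra ℤ G) (m : ℕ)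
    (hm : 0 < m) (hu : u ^ m = 1) (h : partialAugmentation x u ≠ 0) : x ^ m = 1 := by
  classical
  by_contra hx
  have hd : orderOf (x ^ m) ≠ 1 := fun h1 => hx (orderOf_eq_one_iff.1 h1)
  obtain ⟨p, hp, hpd⟩ := Nat.exists_prime_and_dvd hd
  obtain ⟨R, hR⟩ := exists_valuationSubring_residue_charP p hp
  set d := orderOf (x ^ m) with hd'
  have hd0 : 0 < d := orderOf_pos _
  obtain ⟨e, he⟩ := hpd
  have he0 : 0 < e := Nat.pos_of_ne_zero (by rintro rfl; omega)
  have hdiv : m * d / p = m * e := by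
    rw [he, show m * (p * e) = m * e * p by ring, Nat.mul_div_cancel _ hp.pos]
  apply h
  -- For the exponent `m * d`, the power `m * d / p = m * e` kills `u` but leaves `x ^ (m * e)` of
  -- order `p`, so only a free left translation remains.
  apply partialAugmentation_eq_zero_of_ker_le_range p hp R x u (m * d) (Nat.mul_pos hm hd0)
    (he ▸ (dvd_mul_right p e).mul_left m) (by rw [pow_mul, hd', pow_orderOf_eq_one])
    (by rw [pow_mul, hu, one_pow])
  rw [hdiv, pow_mul u, hu, one_pow, translationEnd_group_one]
  apply ker_leftTranslation_sub_one_le p hp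
  · rw [← pow_mul, show m * e * p = m * d by rw [he]; ring, pow_mul, hd', pow_orderOf_eq_one]
  · rw [pow_mul]
    intro h1
    have := Nat.le_of_dvd he0 (orderOf_dvd_of_pow_eq_one h1)
    rw [← hd', he] at this
    have h2 := hp.two_le
    nlinarith

/-- Since `N` is normal, such an `f` is a function on `G ⧸ N`, where `v` acts through its image 1.
-/
lemma translationEnd_one_apply_of_mem_leftInvariants [DecidableEq G] (R : Type*) [CommRing R]
    (N : Subgroup G) [N.Normal] (v : MonoidAlgebra ℤ G)
    (hv : MonoidAlgebra.mapDomainRingHom ℤ (QuotientGroup.mk' N) v = 1) (f : G → R)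
    (hf : f ∈ leftInvariants R N) : translationEnd R 1 v f = f := by
  classical
  ext y
  let F : G ⧸ N → R := Quotient.lift (fun s : G => f (y * s⁻¹)) (by
    intro a b hab
    have hab' : a⁻¹ * b ∈ N := QuotientGroup.leftRel_apply.1 hab
    change f (y * a⁻¹) = f (y * b⁻¹)
    have h1 : y * a⁻¹ = (y * b⁻¹) * (b * (a⁻¹ * b) * b⁻¹) * (y * b⁻¹)⁻¹ * (y * b⁻¹) := by group
    rw [h1]
    exact hf (Subgroup.Normal.conj_mem inferInstance _
      (Subgroup.Normal.conj_mem inferInstance _ hab' b) _) _)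
  have h1 : (Finsupp.mapDomain (QuotientGroup.mk' N) v.coeff).sum (fun q r => (r : R) * F q) =
      f y := by
    have : Finsupp.mapDomain (QuotientGroup.mk' N) v.coeff = (1 : MonoidAlgebra ℤ (G ⧸ N)).coeff :=
      congrArg MonoidAlgebra.coeff hv
    rw [this, MonoidAlgebra.one_def, MonoidAlgebra.coeff_single,
      Finsupp.sum_single_index (by simp), Int.cast_one, one_mul]
    change f (y * 1⁻¹) = f y
    simp
  rw [Finsupp.sum_mapDomain_index (by simp) (by intros; push_cast; ring),
    Finsupp.sum_fintype _ _ (by simp)] at h1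
  rw [translationEnd_apply, ← h1]
  refine Fintype.sum_equiv ((Equiv.inv G).trans (Equiv.mulRight y)) _ _ fun x => ?_
  simp only [Equiv.trans_apply, Equiv.inv_apply, Equiv.coe_mulRight, mul_one]
  congr 1
  change f x = f (y * (x⁻¹ * y)⁻¹)
  congr 1
  group

lemma leftTranslation_commute_translationEnd_one [DecidableEq G] (R : Type*) [CommRing R] (a : G)
    (v : MonoidAlgebra ℤ G) : Commute (leftTranslation R a) (translationEnd R 1 v) := by
  refine LinearMap.ext fun f => funext fun y => ?_
  rw [Module.End.mul_apply, Module.End.mul_apply, translationEnd_apply]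
  change translationEnd R 1 v f (a * y) = _
  rw [translationEnd_apply]
  symm
  refine Fintype.sum_equiv (Equiv.mulLeft a) _ _ fun x => ?_
  simp only [Equiv.coe_mulLeft, mul_one]
  rw [show (a * x)⁻¹ * (a * y) = x⁻¹ * y by group]
  rfl

/-- A unit of order `p` in the kernel of reduction modulo the elementary abelian normal
`p`-subgroup `N` acts freely over fields of characteristic `p`. -/
theorem ker_translationEnd_sub_one_le [DecidableEq G] (p : ℕ) (hp : p.Prime)
    (R : ValuationSubring ℂ) [CharP (ResidueField R) p] (N : Subgroup G) [N.Normal]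
    (hcomm : ∀ a ∈ N, ∀ b ∈ N, a * b = b * a) (hexp : ∀ a ∈ N, a ^ p = 1)
    (v : MonoidAlgebra ℤ G) (haug : augmentation G v = 1) (hvp : v ^ p = 1) (hv1 : v ≠ 1)
    (hv : MonoidAlgebra.mapDomainRingHom ℤ (QuotientGroup.mk' N) v = 1) :
    LinearMap.ker (translationEnd (ResidueField R) 1 v - 1) ≤
      LinearMap.range ((translationEnd (ResidueField R) 1 v - 1) ^ (p - 1)) := by
  set c := translationEnd R (1 : G) v with hc
  have hcp : c ^ p = 1 := by rw [hc, translationEnd_pow, one_pow, hvp, translationEnd_one]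
  set B : Matrix G G R := (translationMatrix 1 v).map (Int.cast : ℤ → R) -
    Matrix.scalar G (1 : R) with hB
  have hBS : ∀ {S : Type} [CommRing S] (φ : R →+* S),
      Matrix.toLin' (B.map φ) = translationEnd S 1 v - 1 := by
    intro S _ φ
    rw [hB, toLin'_map_sub_scalar, map_one, map_one]
    rfl
  have hBR : ∀ x : G → R, B.mulVec x = c x - x := by
    intro x
    have := LinearMap.congr_fun (hBS (RingHom.id R)) x
    simpa using this
  -- For an arbitrary lift `x'`, write `(c - 1) x' = μ y` with `μ` in the maximal ideal. The norm of
  -- `c` kills `y`, so `y = (c - 1) f'` by the vanishing of H¹, and `x' - μ f'` is a fixed lift.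
  have hlift : ∀ x : G → ResidueField R, (B.map (residue R)).mulVec x = 0 →
      ∃ y : G → R, B.mulVec y = 0 ∧ ∀ i, residue R (y i) = x i := by
    intro x hx
    choose x' hx' using fun i => residue_surjective (R := R) (x i)
    obtain ⟨i₀, y, hy⟩ := exists_eq_mul_of_valuationSubring R (B.mulVec x')
    set μ := B.mulVec x' i₀ with hμ
    have hμ0 : residue R μ = 0 := by
      rw [hμ, RingHom.map_mulVec]
      rw [show (residue R : R → ResidueField R) ∘ x' = x from funext hx', hx]
      rfl
    have hy' : c x' - x' = μ • y := by
      rw [← hBR]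
      exact funext hy
    by_cases h0 : μ = 0
    · exact ⟨x', by rw [hBR, hy', h0, zero_smul], hx'⟩
    have hNy : (∑ j ∈ Finset.range p, c ^ j) y = 0 := by
      have h1 : (∑ j ∈ Finset.range p, c ^ j) (c x' - x') = 0 := by
        have := LinearMap.congr_fun (geom_sum_mul c p) x'
        rw [hcp, sub_self, Module.End.mul_apply] at this
        exact this
      rw [hy', map_smul] at h1
      exact (smul_eq_zero.1 h1).resolve_left h0
    obtain ⟨f', hf'⟩ := exists_eq_sub_of_fixes_leftInvariants p hp R N hcomm hexp c hcp
      (fun a _ => leftTranslation_commute_translationEnd_one R a v)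
      (fun f hf => translationEnd_one_apply_of_mem_leftInvariants R N v hv f hf) y hNy
    refine ⟨x' - μ • f', ?_, fun i => ?_⟩
    · rw [hBR, map_sub, map_smul,
        show c x' - μ • c f' - (x' - μ • f') = (c x' - x') - μ • (c f' - f') by
          rw [smul_sub]; abel, hy', ← hf', sub_self]
    · rw [Pi.sub_apply, Pi.smul_apply, smul_eq_mul, map_sub, map_mul, hμ0, zero_mul, sub_zero, hx']
  have hdim := finrank_ker_residue_le_finrank_ker R B hlift
  rw [hBS, hBS] at hdim
  have hC := mul_finrank_ker_translationEnd_sub_one p hp v haug hvp hv1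
  have := Fact.mk hp
  have hchar : CharP (Module.End (ResidueField R) (G → ResidueField R)) p :=
    charP_of_injective_algebraMap (algebraMap (ResidueField R) _).injective p
  -- At most |G|/p Jordan blocks, each of size at most `p`, must fill dimension |G|.
  apply ker_le_range_of_mul_finrank_le _ p hp.pos
  · rw [sub_pow_char_of_commute _ (Commute.one_right _), one_pow, translationEnd_pow, hvp,
      one_pow, translationEnd_one, sub_self]
  · rw [Module.finrank_fintype_fun_eq_card, ← hC]
    exact Nat.mul_le_mul_left p hdim

end Vanishing

/-! ### Lifting order witnesses from quotients -/

section Descent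

variable {G H : Type*} [Group G] [Group H]

lemma augmentation_mapDomainRingHom (f : G →* H) (u : MonoidAlgebra ℤ G) :
    augmentation H (MonoidAlgebra.mapDomainRingHom ℤ f u) = augmentation G u := by
  have : (augmentation H).comp (MonoidAlgebra.mapDomainRingHom ℤ f) = augmentation G := by
    apply MonoidAlgebra.ringHom_ext
    · intro r
      simp [augmentation]
    · intro g
      simp [augmentation]
  exact RingHom.congr_fun this u

open scoped Classical in
lemma partialAugmentation_mapDomainRingHom [Fintype G] [Fintype H] (f : G →* H) (h : H)
    (u : MonoidAlgebra ℤ G) :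
    partialAugmentation h (MonoidAlgebra.mapDomainRingHom ℤ f u) =
      ∑ y with IsConj h (f y), u.coeff y := by
  have h1 : (Finsupp.mapDomain f u.coeff).sum (fun q r => if IsConj h q then r else 0) =
      ∑ y with IsConj h (f y), u.coeff y := by
    rw [Finsupp.sum_mapDomain_index (by simp) (by intros; split_ifs <;> simp),
      Finsupp.sum_fintype _ _ (by simp), Finset.sum_filter]
  rw [← h1, partialAugmentation_eq_sum, Finset.sum_filter, Finsupp.sum_fintype _ _ (by simp)]
  rfl

lemma partialAugmentation_mulEquiv [Finite G] (e : H ≃* G) (g : H) (u : MonoidAlgebra ℤ G) :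
    partialAugmentation g (MonoidAlgebra.mapDomainRingHom ℤ (e.symm : G →* H) u) =
      partialAugmentation (e g) u := by
  classical
  have := Fintype.ofFinite G
  have := Fintype.ofEquiv G e.symm.toEquiv
  rw [partialAugmentation_mapDomainRingHom, partialAugmentation_eq_sum]
  refine Finset.sum_congr (Finset.filter_congr fun y _ => ?_) fun _ _ => rfl
  constructor
  · intro h
    simpa using (e : H →* G).map_isConj h
  · intro h
    simpa using (e.symm : G →* H).map_isConj h

/-- A nonzero partial augmentation of the image of `u` comes from one of `u`. -/
lemma exists_partialAugmentation_ne_zero [Finite G] [Finite H] (f : G →* H) (h : H)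
    (u : MonoidAlgebra ℤ G)
    (hu : partialAugmentation h (MonoidAlgebra.mapDomainRingHom ℤ f u) ≠ 0) :
    ∃ x : G, IsConj h (f x) ∧ partialAugmentation x u ≠ 0 := by
  classical
  have := Fintype.ofFinite G
  have := Fintype.ofFinite H
  by_contra! hx
  apply hu
  -- The preimage of a conjugacy class is a union of classes, so the sum splits into partial
  -- augmentations of `u`.
  rw [partialAugmentation_mapDomainRingHom,
    ← Finset.sum_fiberwise_of_maps_to (g := ConjClasses.mk)
      (fun y hy => Finset.mem_image_of_mem ConjClasses.mk hy)]
  apply Finset.sum_eq_zero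
  intro c hc
  obtain ⟨x, hxS, rfl⟩ := Finset.mem_image.1 hc
  have hxh := (Finset.mem_filter.1 hxS).2
  rw [← hx x hxh, partialAugmentation_eq_sum]
  apply Finset.sum_congr _ fun _ _ => rfl
  ext y
  simp only [Finset.mem_filter, Finset.mem_univ, true_and, ConjClasses.mk_eq_mk_iff_isConj]
  exact ⟨fun h => h.2.symm, fun h => ⟨hxh.trans (f.map_isConj h), h.symm⟩⟩

lemma partialAugmentation_one [Finite G] (u : MonoidAlgebra ℤ G) :
    partialAugmentation 1 u = u.coeff 1 := by
  classical
  have := Fintype.ofFinite G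
  rw [partialAugmentation_eq_sum]
  simp only [isConj_one_right]
  rw [Finset.sum_filter]
  simp

/-- A torsion unit of prime order `r` in the kernel of reduction modulo a normal subgroup of
exponent `p` satisfies `r = p`. -/
lemma eq_of_prime_pow_eq_one_of_map_eq_one [Finite G] (p r : ℕ) (hp : p.Prime) (hr : r.Prime)
    (N : Subgroup G) [N.Normal] (hexp : ∀ a ∈ N, a ^ p = 1) (v : MonoidAlgebra ℤ G)
    (haug : augmentation G v = 1) (hvr : v ^ r = 1) (hv1 : v ≠ 1)
    (hv : MonoidAlgebra.mapDomainRingHom ℤ (QuotientGroup.mk' N) v = 1) : r = p := by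
  classical
  have := Fintype.ofFinite G
  by_contra hne
  obtain ⟨x, hx, hx0⟩ := exists_partialAugmentation_ne_zero (QuotientGroup.mk' N) 1 v (by
    rw [hv, partialAugmentation_one, MonoidAlgebra.coeff_one_one]
    exact one_ne_zero)
  have hxN : x ∈ N := by
    rw [isConj_one_right] at hx
    exact (QuotientGroup.eq_one_iff x).1 hx
  have hxr := pow_eq_one_of_partialAugmentation_ne_zero x v r hr.pos hvr hx0
  -- The order of `x` divides both primes `r` and `p`; Berman–Higman then rules out `x = 1`.
  have hx1 : x = 1 := by
    have hc : r.Coprime p := (Nat.coprime_primes hr hp).2 hne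
    simpa [hc.gcd_eq_one] using pow_gcd_eq_one.2 ⟨hxr, hexp x hxN⟩
  rw [hx1, partialAugmentation_one] at hx0
  exact hv1 (eq_one_of_coeff_one_ne_zero v haug r hr.pos hvr hx0)

/-- Every torsion element of augmentation one has a nonzero partial augmentation at a group element
of the same order. -/
def HasOrderWitnesses (G : Type*) [Group G] : Prop :=
  ∀ u : MonoidAlgebra ℤ G, augmentation G u = 1 → IsOfFinOrder u →
    ∃ g : G, orderOf g = orderOf u ∧ partialAugmentation g u ≠ 0

/-- Elements of finite order are automatically units, so the descent can work in the ring itself,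
where passing to quotients is simpler. -/
lemma hasOrderWitnesses_iff (G : Type*) [Group G] : HasOrderWitnesses G ↔
    ∀ u : normalizedUnits G, IsOfFinOrder u → ∃ g : G, orderOf g = orderOf u ∧
      partialAugmentation g ((u : (MonoidAlgebra ℤ G)ˣ) : MonoidAlgebra ℤ G) ≠ 0 := by
  have hord : ∀ u : normalizedUnits G,
      orderOf ((u : (MonoidAlgebra ℤ G)ˣ) : MonoidAlgebra ℤ G) = orderOf u := fun u => by
    rw [orderOf_units, Subgroup.orderOf_coe]
  constructor
  · intro h u hu
    obtain ⟨g, hg, hg'⟩ := h ((u : (MonoidAlgebra ℤ G)ˣ) : MonoidAlgebra ℤ G) (congrArg Units.val (MonoidHom.mem_ker.1 u.2)) (by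
      rw [← orderOf_pos_iff, hord]; exact orderOf_pos_iff.2 hu)
    exact ⟨g, hg.trans (hord u), hg'⟩
  · intro h u haug hu
    obtain ⟨n, hn, hun⟩ := isOfFinOrder_iff_pow_eq_one.1 hu
    let w : normalizedUnits G := ⟨Units.ofPowEqOne u n hun hn.ne', by
      rw [normalizedUnits, MonoidHom.mem_ker]
      exact Units.ext haug⟩
    obtain ⟨g, hg, hg'⟩ := h w (by
      rw [← orderOf_pos_iff, ← hord]; exact orderOf_pos_iff.2 hu)
    exact ⟨g, hg.trans (hord w).symm, hg'⟩

lemma HasOrderWitnesses.of_mulEquiv [Finite G] (e : H ≃* G) (h : HasOrderWitnesses H) :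
    HasOrderWitnesses G := by
  intro u haug hu
  have hinj : Function.Injective (MonoidAlgebra.mapDomainRingHom ℤ (e.symm : G →* H)) :=
    MonoidAlgebra.mapDomain_injective e.symm.injective
  have hord : orderOf (MonoidAlgebra.mapDomainRingHom ℤ (e.symm : G →* H) u) = orderOf u :=
    orderOf_injective (MonoidAlgebra.mapDomainRingHom ℤ (e.symm : G →* H)).toMonoidHom hinj u
  obtain ⟨g, hg, hg'⟩ := h (MonoidAlgebra.mapDomainRingHom ℤ (e.symm : G →* H) u)
    (by rw [augmentation_mapDomainRingHom, haug])
    (by rw [← orderOf_pos_iff, hord]; exact orderOf_pos_iff.2 hu)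
  exact ⟨e g, by rw [MulEquiv.orderOf_eq, hg, hord], by
    rwa [← partialAugmentation_mulEquiv]⟩

/-- Lifting order witnesses along the quotient by an elementary abelian normal subgroup. -/
theorem HasOrderWitnesses.of_quotient_elementaryAbelian [Finite G] (p : ℕ) (hp : p.Prime)
    (N : Subgroup G) [N.Normal] (hcomm : ∀ a ∈ N, ∀ b ∈ N, a * b = b * a)
    (hexp : ∀ a ∈ N, a ^ p = 1) (h : HasOrderWitnesses (G ⧸ N)) : HasOrderWitnesses G := by
  classical
  have := Fintype.ofFinite G
  intro u haug hu
  set φ := MonoidAlgebra.mapDomainRingHom ℤ (QuotientGroup.mk' N) with hφ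
  have hφdvd : orderOf (φ u) ∣ orderOf u := orderOf_map_dvd φ.toMonoidHom u
  have hpos : 0 < orderOf u := orderOf_pos_iff.2 hu
  obtain ⟨g, hg, hg0⟩ := h (φ u) (by rw [hφ, augmentation_mapDomainRingHom, haug])
    (orderOf_pos_iff.1 (Nat.pos_of_dvd_of_pos hφdvd hpos))
  obtain ⟨x, hx, hx0⟩ := exists_partialAugmentation_ne_zero (QuotientGroup.mk' N) g u hg0
  have hxu : orderOf x ∣ orderOf u := orderOf_dvd_of_pow_eq_one
    (pow_eq_one_of_partialAugmentation_ne_zero x u _ hpos (pow_orderOf_eq_one u) hx0)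
  have hφx : orderOf (φ u) ∣ orderOf x := by
    rw [← hg]
    obtain ⟨c, hc⟩ := isConj_iff.1 hx
    have h1 : orderOf (QuotientGroup.mk' N x) = orderOf g := by
      rw [← hc]
      exact MulEquiv.orderOf_eq (MulAut.conj c) g
    rw [← h1]
    exact orderOf_map_dvd _ x
  refine ⟨x, ?_, hx0⟩
  by_contra hne
  obtain ⟨d, hd⟩ := hxu
  have hd1 : d ≠ 1 := by rintro rfl; exact hne (by rw [hd, mul_one])
  obtain ⟨r, hr, e, rfl⟩ := Nat.exists_prime_and_dvd hd1
  have hdiv : orderOf u / r = orderOf x * e := by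
    rw [hd, show orderOf x * (r * e) = orderOf x * e * r by ring, Nat.mul_div_cancel _ hr.pos]
  have hru : r ∣ orderOf u := hd ▸ (dvd_mul_right r e).mul_left _
  have hxr : x ^ (orderOf u / r) = 1 := by rw [hdiv, pow_mul, pow_orderOf_eq_one, one_pow]
  have hvr : (u ^ (orderOf u / r)) ^ r = 1 := by
    rw [← pow_mul, Nat.div_mul_cancel hru, pow_orderOf_eq_one]
  have hv1 : u ^ (orderOf u / r) ≠ 1 := pow_ne_one_of_lt_orderOf
    (Nat.div_pos (Nat.le_of_dvd hpos hru) hr.pos).ne' (Nat.div_lt_self hpos hr.one_lt)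
  have hvφ : φ (u ^ (orderOf u / r)) = 1 := by
    obtain ⟨s, hs⟩ := hφx
    rw [map_pow, hdiv, hs, mul_assoc, pow_mul, pow_orderOf_eq_one, one_pow]
  have hvaug : augmentation G (u ^ (orderOf u / r)) = 1 := by rw [map_pow, haug, one_pow]
  obtain rfl := eq_of_prime_pow_eq_one_of_map_eq_one p r hp hr N hexp _ hvaug hvr hv1 hvφ
  obtain ⟨R, hR⟩ := exists_valuationSubring_residue_charP r hr
  apply hx0
  apply partialAugmentation_eq_zero_of_ker_le_range r hr R x u (orderOf u) hpos hru
    (by rw [hd, pow_mul, pow_orderOf_eq_one, one_pow]) (pow_orderOf_eq_one u)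
  rw [hxr]
  exact ker_translationEnd_sub_one_le r hr R N hcomm hexp _ hvaug hvr hv1 hvφ

/-- A nontrivial soluble normal subgroup of a finite group contains a nontrivial elementary abelian
subgroup that is normal in the whole group. -/
lemma exists_normal_elementaryAbelian [Finite G] (N : Subgroup G) [N.Normal]
    (hN : Group.IsSolvable N) (hN1 : N ≠ ⊥) :
    ∃ (p : ℕ) (A : Subgroup G), p.Prime ∧ A.Normal ∧ A ≤ N ∧ A ≠ ⊥ ∧
      (∀ a ∈ A, ∀ b ∈ A, a * b = b * a) ∧ ∀ a ∈ A, a ^ p = 1 := by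
  classical
  have hex : ∃ k, derivedSeries N k = ⊥ := hN.solvable
  have hk0 : Nat.find hex ≠ 0 := by
    intro h0
    have := Nat.find_spec hex
    rw [h0, derivedSeries_zero] at this
    apply hN1
    rw [eq_bot_iff]
    intro x hx
    have hx' : (⟨x, hx⟩ : N) ∈ (⊥ : Subgroup N) := this ▸ Subgroup.mem_top _
    exact Subgroup.mem_bot.2 (congrArg Subtype.val (Subgroup.mem_bot.1 hx'))
  obtain ⟨k, hk⟩ := Nat.exists_eq_succ_of_ne_zero hk0
  have hD1 : derivedSeries N k ≠ ⊥ := Nat.find_min hex (by omega)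
  have hD2 : derivedSeries N (k + 1) = ⊥ := by
    have := Nat.find_spec hex
    rwa [hk] at this
  -- The last nontrivial derived term is abelian and characteristic in `N`, hence normal in `G`; its
  -- elements killed by `p` then form the required subgroup.
  set B : Subgroup G := (derivedSeries N k).map N.subtype with hB
  have hBn : B.Normal := inferInstance
  have hBcomm : ∀ a ∈ B, ∀ b ∈ B, a * b = b * a := by
    rintro _ ⟨a, ha, rfl⟩ _ ⟨b, hb, rfl⟩
    rw [derivedSeries_succ, Subgroup.commutator_eq_bot_iff_le_centralizer] at hD2
    have := Subgroup.mem_centralizer_iff.1 (hD2 hb) a ha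
    exact congrArg N.subtype this
  have hB1 : B ≠ ⊥ := by
    intro h
    exact hD1 ((Subgroup.map_eq_bot_iff_of_injective _ N.subtype_injective).1 h)
  have hcard : Nat.card B ≠ 1 := fun h => hB1 (Subgroup.card_eq_one.1 h)
  obtain ⟨p, hp, hpB⟩ := Nat.exists_prime_and_dvd hcard
  have := Fact.mk hp
  obtain ⟨b, hb⟩ := exists_prime_orderOf_dvd_card' p hpB
  let A : Subgroup G :=
    { carrier := {x | x ∈ B ∧ x ^ p = 1}
      one_mem' := ⟨B.one_mem, one_pow p⟩
      mul_mem' := fun {x y} hx hy => ⟨B.mul_mem hx.1 hy.1, by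
        have hxy : Commute x y := hBcomm x hx.1 y hy.1
        rw [hxy.mul_pow, hx.2, hy.2, one_mul]⟩
      inv_mem' := fun {x} hx => ⟨B.inv_mem hx.1, by rw [inv_pow, hx.2, inv_one]⟩ }
  refine ⟨p, A, hp, ⟨fun x hx g => ⟨hBn.conj_mem x hx.1 g, by
    rw [conj_pow, hx.2, mul_one, mul_inv_cancel]⟩⟩, fun x hx => ?_, fun h => ?_,
    fun x hx y hy => hBcomm x hx.1 y hy.1, fun x hx => hx.2⟩
  · obtain ⟨y, -, rfl⟩ := hx.1
    exact y.2
  · have hbA : (b : G) ∈ A := ⟨b.2, by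
      have := pow_orderOf_eq_one b
      rw [hb] at this
      exact congrArg Subtype.val this⟩
    rw [h, Subgroup.mem_bot] at hbA
    have hb1 : b = 1 := Subtype.ext hbA
    rw [hb1, orderOf_one] at hb
    exact hp.one_lt.ne hb

/-- Lifting order witnesses along the quotient by a soluble normal subgroup. -/
theorem HasOrderWitnesses.of_quotient_isSolvable {G : Type*} [Group G] [Finite G]
    (N : Subgroup G) [N.Normal] (hN : Group.IsSolvable N) (h : HasOrderWitnesses (G ⧸ N)) :
    HasOrderWitnesses G := by
  induction hn : Nat.card G using Nat.strong_induction_on generalizing G with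
  | _ n ih =>
  by_cases hN1 : N = ⊥
  · subst hN1
    exact h.of_mulEquiv QuotientGroup.quotientBot
  obtain ⟨p, A, hp, hAn, hAN, hA1, hcomm, hexp⟩ := exists_normal_elementaryAbelian N hN hN1
  apply HasOrderWitnesses.of_quotient_elementaryAbelian p hp A hcomm hexp
  have hNn : (N.map (QuotientGroup.mk' A)).Normal :=
    Subgroup.Normal.map inferInstance _ (QuotientGroup.mk'_surjective A)
  refine ih (Nat.card (G ⧸ A)) ?_ (N.map (QuotientGroup.mk' A)) ?_ ?_ rfl
  · rw [← hn, A.card_eq_card_quotient_mul_card_subgroup]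
    have h1 : 0 < Nat.card (G ⧸ A) := Nat.card_pos
    have h2 : 1 < Nat.card A := (Subgroup.one_lt_card_iff_ne_bot A).2 hA1
    nlinarith
  · exact Group.isSolvable_of_surjective ((QuotientGroup.mk' A).subgroupMap_surjective N)
  · exact h.of_mulEquiv (QuotientGroup.quotientQuotientEquivQuotient A N hAN).symm

lemma HasOrderWitnesses.sipc {G : Type*} [Group G] (h : HasOrderWitnesses G) : SIPC G := by
  intro C hfin hcyc
  obtain ⟨c, hc⟩ := IsCyclic.exists_generator (α := C)
  have hcfin : IsOfFinOrder (c : normalizedUnits G) :=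
    Submonoid.isOfFinOrder_coe.2 (isOfFinOrder_of_finite c)
  obtain ⟨g, hg, -⟩ := (hasOrderWitnesses_iff G).1 h c hcfin
  refine ⟨Subgroup.zpowers g, ⟨mulEquivOfCyclicCardEq ?_⟩⟩
  rw [Nat.card_zpowers, hg, Subgroup.orderOf_coe, orderOf_eq_card_of_forall_mem_zpowers hc]

end Descent

theorem mainTheorem7 {G : Type*} [Group G] [Finite G] (N : Subgroup G) [N.Normal]
    (hN : Group.IsSolvable N)
    (hQ : ∀ u : normalizedUnits (G ⧸ N), IsOfFinOrder u →
      ∃ g : G ⧸ N, orderOf g = orderOf u ∧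
        partialAugmentation g ((u : (MonoidAlgebra ℤ (G ⧸ N))ˣ) : MonoidAlgebra ℤ (G ⧸ N)) ≠ 0) :
    (∀ u : normalizedUnits G, IsOfFinOrder u →
      ∃ g : G, orderOf g = orderOf u ∧
        partialAugmentation g ((u : (MonoidAlgebra ℤ G)ˣ) : MonoidAlgebra ℤ G) ≠ 0) ∧
    SIPC G := by
  have h := ((hasOrderWitnesses_iff (G ⧸ N)).2 hQ).of_quotient_isSolvable N hN
  exact ⟨(hasOrderWitnesses_iff G).1 h, h.sipc⟩
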